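/- Let $\mathcal A=(L_1,\dots,L_n)$ be an arrangement of $n$ distinct lines in $\mathbb{CP}^2$. Its total space $\mathcal T_{\mathcal A}\subset((\mathbb{CP}^2)^*)^n$ is the set of $n$-tuples $(P_1,\dots,P_n)$ of distinct points of the dual plane such that, for all $i,j,k$, $\det(P_i,P_j,P_k)=0$ if and only if $L_i\cap L_j\cap L_k\neq\emptyset$; it carries the Zariski topology induced from $((\mathbb{CP}^2)^*)^n$. The moduli space of $\mathcal A$ is the topological quotient $\mathcal M_{\mathcal A}=\mathcal T_{\mathcal A}/PGL(3,\mathbb C)$. A pair of arrangements $\mathcal A,\mathcal B$ is a potential Zariski pair if, for some relabelling of the lines of $\mathcal B$ that identifies the intersection lattices of $\mathcal A$ and $\mathcal B$, the points of $\mathcal M_{\mathcal A}$ given by $\mathcal A$ and by the relabelled $\mathcal B$ lie neither in a common irreducible component of $\mathcal M_{\mathcal A}$ nor in two complex conjugate ones. **Theorem 6.2.** Consider the arrangements of ten lines in $\mathbb{CP}^2$ with only double and triple points, with at least three triple points on each line, and with exactly ten triple points. Up to relabelling the lines, each of them realizes exactly one of the following nine configuration tables, and each of the nine is realized (the ten triples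 list, for $L_1,\dots,L_{10}$ in this order, the indices of the triple points $e_1,\dots,e_{10}$ on that line, with $10$ written as $0$; three lines are concurrent exactly when they share one of the listed points): 1. 167, 123, 145, 248, 358, 890, 269, 379, 460, 570 2. 123, 145, 167, 460, 570, 890, 248, 378, 269, 359 3. 123, 145, 167, 460, 570, 890, 248, 368, 279, 359 4. 123, 145, 167, 248, 378, 890, 259, 469, 360, 570 5. 123, 145, 167, 248, 378, 890, 269, 579, 350, 460 6. 123, 145, 167, 289, 480, 578, 246, 359, 370, 690 7. 123, 145, 167, 389, 580, 790, 278, 569, 340, 246 8. 123, 145, 167, 289, 480, 690, 578, 359, 270, 346 9. 123, 145, 167, 389, 280, 790, 578, 569, 340, 246 For every such arrangement $\mathcal A$ the moduli space $\mathcal M_{\mathcal A}$ is irreducible. Consequently no such arrangement belongs to a potential Zariski pair. -/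

import Mathlib

open scoped LinearAlgebra.Projectivization

namespace LineArrangement

/-- The complex projective plane. -/
abbrev Plane : Type := ℙ ℂ (Fin 3 → ℂ)

/-- The dual projective plane: `[a, b, c]` stands for the line `ax + by + cz = 0`. -/
abbrev DualPlane : Type := ℙ ℂ (Fin 3 → ℂ)

/-- The projective line, as a set of points, with dual coordinates `P`. -/
def line (P : DualPlane) : Set Plane := {x | Projectivization.orthogonal P x}

/-! Ordered line arrangements are injective families `A : Fin n → DualPlane`. -/

section Combinatorics

variable {n : ℕ}

/-- The intersection of the lines with labels in `S` (the whole plane if `S = ∅`): these sets,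
ordered by reverse inclusion, form the intersection lattice of `A`. -/
def flat (A : Fin n → DualPlane) (S : Finset (Fin n)) : Set Plane := ⋂ i ∈ S, line (A i)

/-- The labelled families `A` and `B` have the same intersection lattice, with the same labels. -/
def SameLattice (A B : Fin n → DualPlane) : Prop :=
  ∀ S T : Finset (Fin n), flat A S ⊆ flat A T ↔ flat B S ⊆ flat B T

/-- The number of lines of `A` through the point `x`. -/
noncomputable def multiplicity (A : Fin n → DualPlane) (x : Plane) : ℕ :=
  {i | x ∈ line (A i)}.ncard

/-- The triple points of `A`. -/
def triplePoints (A : Fin n → DualPlane) : Set Plane := {x | multiplicity A x = 3}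

/-- Arrangements of ten (distinct) lines with only double and triple points, at least three triple
points on each line, and exactly ten triple points. -/
structure IsTenLinesTenTriples (A : Fin 10 → DualPlane) : Prop where
  injective : Function.Injective A
  multiplicity_le : ∀ x, multiplicity A x ≤ 3
  three_le : ∀ i, 3 ≤ (triplePoints A ∩ line (A i)).ncard
  ten_triples : (triplePoints A).ncard = 10

/-- A configuration table with `n` columns: column `j` lists the labels of the multiple points
(of order at least three) on the `j`-th line. -/
abbrev ConfigurationTable (n : ℕ) : Type := Fin n → Finset ℕ

/-- The arrangement `A` is associated to the table `C`: three lines of `A` are concurrent exactly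
when the corresponding columns of `C` share a point. -/
def HasTable (A : Fin n → DualPlane) (C : ConfigurationTable n) : Prop :=
  Function.Injective A ∧
    ∀ i j k, i ≠ j → i ≠ k → j ≠ k →
      ((line (A i) ∩ line (A j) ∩ line (A k)).Nonempty ↔ ∃ e, e ∈ C i ∧ e ∈ C j ∧ e ∈ C k)

end Combinatorics

section Zariski

variable (n : ℕ)

/-- A polynomial in the coordinates `x i 0, x i 1, x i 2` of `n` points which is homogeneous
separately in the three coordinates of each point. -/
def IsMultihomogeneous (F : MvPolynomial (Fin n × Fin 3) ℂ) : Prop :=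
  ∃ d : Fin n → ℕ, F.IsWeightedHomogeneous (fun p : Fin n × Fin 3 => Pi.single p.1 (1 : ℕ)) d

/-- The set of `n`-tuples of projective points at which `F` does not vanish. For multihomogeneous
`F` this does not depend on the choice of homogeneous coordinates. -/
def nonvanishing (F : MvPolynomial (Fin n × Fin 3) ℂ) : Set (Fin n → DualPlane) :=
  {P | MvPolynomial.eval (fun p => (P p.1).rep p.2) F ≠ 0}

/-- The Zariski topology on the product of `n` copies of the (dual) projective plane: the closed
sets are the common zero loci of families of multihomogeneous polynomials. -/
abbrev zariskiTopology : TopologicalSpace (Fin n → DualPlane) :=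
  TopologicalSpace.generateFrom {U | ∃ F, IsMultihomogeneous n F ∧ U = nonvanishing n F}

end Zariski

section Moduli

variable {n : ℕ}

/-- The determinant of the coefficient matrix of three lines; only its vanishing matters, and that
does not depend on the choice of homogeneous coordinates. -/
noncomputable def coeffDet (P Q R : DualPlane) : ℂ :=
  (Matrix.of ![P.rep, Q.rep, R.rep]).det

/-- The total space of `A`: tuples of distinct dual points such that the determinants of triples
vanish exactly for the concurrent triples of lines of `A`. -/
def totalSet (A : Fin n → DualPlane) : Set (Fin n → DualPlane) :=
  {P | Function.Injective P ∧ ∀ i j k,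
    ((line (A i) ∩ line (A j) ∩ line (A k)).Nonempty → coeffDet (P i) (P j) (P k) = 0) ∧
    (line (A i) ∩ line (A j) ∩ line (A k) = ∅ → coeffDet (P i) (P j) (P k) ≠ 0)}

/-- The total space of `A` as a space of its own, with the Zariski topology. -/
def TotalSpace (A : Fin n → DualPlane) : Type := {P : Fin n → DualPlane // P ∈ totalSet A}

instance (A : Fin n → DualPlane) : TopologicalSpace (TotalSpace A) :=
  (zariskiTopology n).induced Subtype.val

/-- Two tuples are projectively equivalent if an element of `PGL(3, ℂ)` carries one to the
other. -/
def ProjEquiv (A : Fin n → DualPlane) (P Q : TotalSpace A) : Prop :=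
  ∃ g : Matrix.ProjGenLinGroup (Fin 3) ℂ, ∀ i, Q.1 i = g • P.1 i

/-- The moduli space of `A`: the quotient of the total space by `PGL(3, ℂ)`, with the quotient of
the Zariski topology. -/
def ModuliSpace (A : Fin n → DualPlane) : Type := Quot (ProjEquiv A)

instance (A : Fin n → DualPlane) : TopologicalSpace (ModuliSpace A) :=
  inferInstanceAs (TopologicalSpace (Quot (ProjEquiv A)))

/-- The class in the moduli space of a point of the total space. -/
def TotalSpace.toModuli {A : Fin n → DualPlane} (P : TotalSpace A) : ModuliSpace A :=
  Quot.mk _ P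

/-- Complex conjugation on the projective plane. -/
noncomputable def conj (P : DualPlane) : DualPlane :=
  Projectivization.mk ℂ (star P.rep) (star_ne_zero.mpr P.rep_nonzero)

/-- A potential Zariski pair: two arrangements that are lattice isomorphic through some relabelling
`σ` of the lines, for which the points `A` and `B ∘ σ` of the moduli space of `A` lie neither in one
irreducible component nor in two complex conjugate ones. -/
def IsPotentialZariskiPair (A B : Fin n → DualPlane) : Prop :=
  Function.Injective A ∧ Function.Injective B ∧
    ∃ σ : Equiv.Perm (Fin n), SameLattice A (B ∘ σ) ∧
      ¬ ∃ P Q : TotalSpace A, P.1 = A ∧ (Q.1 = B ∘ σ ∨ Q.1 = conj ∘ B ∘ σ) ∧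
        ∃ Z ∈ irreducibleComponents (ModuliSpace A), P.toModuli ∈ Z ∧ Q.toModuli ∈ Z

end Moduli

/-- The nine tables of the geometric configurations of ten lines and ten triple points; the columns
are the lines `L₁, …, L₁₀`, and `k` stands for the triple point `e_k`. The first one is the
Desargues configuration. -/
def tenThreeTable : Fin 9 → ConfigurationTable 10 :=
  ![![{1, 6, 7}, {1, 2, 3}, {1, 4, 5}, {2, 4, 8}, {3, 5, 8}, {8, 9, 10}, {2, 6, 9}, {3, 7, 9},
      {4, 6, 10}, {5, 7, 10}],
    ![{1, 2, 3}, {1, 4, 5}, {1, 6, 7}, {4, 6, 10}, {5, 7, 10}, {8, 9, 10}, {2, 4, 8}, {3, 7, 8},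
      {2, 6, 9}, {3, 5, 9}],
    ![{1, 2, 3}, {1, 4, 5}, {1, 6, 7}, {4, 6, 10}, {5, 7, 10}, {8, 9, 10}, {2, 4, 8}, {3, 6, 8},
      {2, 7, 9}, {3, 5, 9}],
    ![{1, 2, 3}, {1, 4, 5}, {1, 6, 7}, {2, 4, 8}, {3, 7, 8}, {8, 9, 10}, {2, 5, 9}, {4, 6, 9},
      {3, 6, 10}, {5, 7, 10}],
    ![{1, 2, 3}, {1, 4, 5}, {1, 6, 7}, {2, 4, 8}, {3, 7, 8}, {8, 9, 10}, {2, 6, 9}, {5, 7, 9},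
      {3, 5, 10}, {4, 6, 10}],
    ![{1, 2, 3}, {1, 4, 5}, {1, 6, 7}, {2, 8, 9}, {4, 8, 10}, {5, 7, 8}, {2, 4, 6}, {3, 5, 9},
      {3, 7, 10}, {6, 9, 10}],
    ![{1, 2, 3}, {1, 4, 5}, {1, 6, 7}, {3, 8, 9}, {5, 8, 10}, {7, 9, 10}, {2, 7, 8}, {5, 6, 9},
      {3, 4, 10}, {2, 4, 6}],
    ![{1, 2, 3}, {1, 4, 5}, {1, 6, 7}, {2, 8, 9}, {4, 8, 10}, {6, 9, 10}, {5, 7, 8}, {3, 5, 9},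
      {2, 7, 10}, {3, 4, 6}],
    ![{1, 2, 3}, {1, 4, 5}, {1, 6, 7}, {3, 8, 9}, {2, 8, 10}, {7, 9, 10}, {5, 7, 8}, {5, 6, 9},
      {3, 4, 10}, {2, 4, 6}]]

end LineArrangement

open scoped Topology

namespace LineArrangement

/-! ### The Zariski topology on tuples of projective points -/

section Zariski

variable {n : ℕ}

/-! The proof has a combinatorial half and a geometric half, joined by configuration tables.

Combinatorics: ten triple points give 30 incidences with the lines, and each line has at least three
of them, so each line has exactly three. The triple points, as sets of line labels, thus form a
combinatorial configuration of ten elements and ten blocks (`IsTenThree`). A symmetry-reduced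
exhaustive search, evaluated by the kernel and proved sound in `search_sound`, shows that each such
configuration is one of ten, up to relabelling: the nine tables and `antiTable`. A determinant
computation excludes the last one (`not_isRealization_antiTable`). The nine tables are told apart by
two invariants of the graph of double points (`TableIso.eq`), and explicit integral coordinates
realize each of them.

Geometry: four lines in general position are moved to the standard frame, and the other lines are
built one after another from incidences. Nine of the ten incidences are used up with three
parameters left; the tenth is one equation in them. It holds identically for the first table
(Desargues' theorem). For `tenThreeTable` 1, 2, 4 and 5 it becomes linear after cancellation of
nonzero factors and eliminates a parameter. For 3, 6, 7 and 8 it is quadratic in one parameter and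
irreducible by Eisenstein's criterion. In all cases the realizations are parametrized, up to
projective equivalence, by an open part of the zero set of a prime principal ideal (`HasChart`).

Two nonempty open sets of the moduli space pull back to nonempty open sets of this irreducible
parameter space, so they meet (`irreducibleSpace_moduliSpace_of_chart`). An arrangement with the
same lattice defines a point of the same total space (`SameLattice.mem_totalSet`), and an
irreducible moduli space has only one component, so there are no potential Zariski pairs. -/

theorem IsMultihomogeneous.mul {F G : MvPolynomial (Fin n × Fin 3) ℂ}
    (hF : IsMultihomogeneous n F) (hG : IsMultihomogeneous n G) :
    IsMultihomogeneous n (F * G) := by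
  obtain ⟨d, hd⟩ := hF
  obtain ⟨e, he⟩ := hG
  exact ⟨d + e, hd.mul he⟩

theorem isMultihomogeneous_one : IsMultihomogeneous n 1 :=
  ⟨0, MvPolynomial.isWeightedHomogeneous_one _ _⟩

theorem nonvanishing_mul (F G : MvPolynomial (Fin n × Fin 3) ℂ) :
    nonvanishing n (F * G) = nonvanishing n F ∩ nonvanishing n G := by
  ext P
  simp [nonvanishing]

theorem nonvanishing_one : nonvanishing n 1 = Set.univ := by
  ext P
  simp [nonvanishing]

/-- The generating sets form a basis of the topology, because products of polynomials realize finite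
intersections. -/
theorem exists_nonvanishing_subset {U : Set (Fin n → DualPlane)}
    (hU : IsOpen[zariskiTopology n] U) {P : Fin n → DualPlane} (hP : P ∈ U) :
    ∃ F, IsMultihomogeneous n F ∧ P ∈ nonvanishing n F ∧ nonvanishing n F ⊆ U := by
  have hU' : TopologicalSpace.GenerateOpen
    {U | ∃ F, IsMultihomogeneous n F ∧ U = nonvanishing n F} U := hU
  clear hU
  induction hU' with
  | basic s hs =>
    obtain ⟨F, hF, rfl⟩ := hs
    exact ⟨F, hF, hP, subset_rfl⟩
  | univ => exact ⟨1, isMultihomogeneous_one, by simp [nonvanishing_one], Set.subset_univ _⟩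
  | inter s t _ _ ihs iht =>
    obtain ⟨F, hF, hPF, hs⟩ := ihs hP.1
    obtain ⟨G, hG, hPG, ht⟩ := iht hP.2
    refine ⟨F * G, hF.mul hG, ?_, ?_⟩
    · rw [nonvanishing_mul]
      exact ⟨hPF, hPG⟩
    · rw [nonvanishing_mul]
      exact Set.inter_subset_inter hs ht
  | sUnion S _ ih =>
    obtain ⟨s, hs, hPs⟩ := hP
    obtain ⟨F, hF, hPF, h⟩ := ih s hs hPs
    exact ⟨F, hF, hPF, h.trans (Set.subset_sUnion_of_mem hs)⟩

/-- All monomials have the same degree `d i` in the coordinates of the `i`-th point, so each one is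
multiplied by the same `∏ i, c i ^ d i`. -/
theorem IsMultihomogeneous.exists_eval_smul {F : MvPolynomial (Fin n × Fin 3) ℂ}
    (hF : IsMultihomogeneous n F) (c : Fin n → ℂ) (hc : ∀ i, c i ≠ 0) :
    ∃ r : ℂ, r ≠ 0 ∧ ∀ x : Fin n → Fin 3 → ℂ,
      MvPolynomial.eval (fun p => c p.1 * x p.1 p.2) F =
        r * MvPolynomial.eval (fun p => x p.1 p.2) F := by
  obtain ⟨d, hd⟩ := hF
  refine ⟨∏ i, c i ^ d i, Finset.prod_ne_zero_iff.2 fun i _ => pow_ne_zero _ (hc i), fun x => ?_⟩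
  rw [MvPolynomial.eval_eq', MvPolynomial.eval_eq', Finset.mul_sum]
  refine Finset.sum_congr rfl fun m hm => ?_
  have hw := hd (MvPolynomial.mem_support_iff.1 hm)
  have hi : ∀ i, ∑ j, m (i, j) = d i := by
    intro i
    rw [← hw, Finsupp.weight_apply, Finsupp.sum_fintype _ _ (by simp), Finset.sum_apply,
      Fintype.sum_prod_type, Finset.sum_eq_single i]
    · simp
    · intro b _ hb
      simp [hb.symm]
    · simp
  have : ∏ p : Fin n × Fin 3, c p.1 ^ m p = ∏ i, c i ^ d i := by
    rw [Fintype.prod_prod_type]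
    refine Finset.prod_congr rfl fun i _ => ?_
    simp only [← hi i, Finset.prod_pow_eq_pow_sum]
  simp only [mul_pow, Finset.prod_mul_distrib, this]
  ring

/-- This replaces the uncontrolled representatives `rep` by coordinates that depend polynomially on
parameters. -/
theorem mem_nonvanishing_iff {F : MvPolynomial (Fin n × Fin 3) ℂ}
    (hF : IsMultihomogeneous n F) (x : Fin n → Fin 3 → ℂ) (hx : ∀ i, x i ≠ 0) :
    (fun i => Projectivization.mk ℂ (x i) (hx i)) ∈ nonvanishing n F ↔
      MvPolynomial.eval (fun p => x p.1 p.2) F ≠ 0 := by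
  choose c hc using fun i => Projectivization.exists_smul_eq_mk_rep ℂ (x i) (hx i)
  obtain ⟨r, hr, h⟩ := hF.exists_eval_smul (fun i => (c i : ℂ)) fun i => (c i).ne_zero
  have : (fun p : Fin n × Fin 3 => (Projectivization.mk ℂ (x p.1) (hx p.1)).rep p.2) =
      fun p => (c p.1 : ℂ) * x p.1 p.2 := by
    ext p
    rw [← hc p.1]
    rfl
  simp only [nonvanishing, Set.mem_ofPred_eq, this, h, ne_eq, mul_eq_zero, hr, false_or]

end Zariski

/-! ### Concurrency and determinants -/

section Det

variable {R : Type*} [CommRing R]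

/-- The determinant of three vectors. -/
def det3 (x y z : Fin 3 → R) : R :=
  x 0 * (y 1 * z 2 - y 2 * z 1) - x 1 * (y 0 * z 2 - y 2 * z 0) + x 2 * (y 0 * z 1 - y 1 * z 0)

theorem det3_eq_det (x y z : Fin 3 → R) : det3 x y z = (Matrix.of ![x, y, z]).det := by
  rw [Matrix.det_fin_three, det3]
  simp
  ring

theorem det3_smul (a b c : R) (x y z : Fin 3 → R) :
    det3 (a • x) (b • y) (c • z) = a * b * c * det3 x y z := by
  simp [det3]
  ring

theorem det3_mulVec (g : Matrix (Fin 3) (Fin 3) R) (x y z : Fin 3 → R) :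
    det3 (g.mulVec x) (g.mulVec y) (g.mulVec z) = g.det * det3 x y z := by
  simp only [det3, Matrix.det_fin_three, Matrix.mulVec, dotProduct, Fin.sum_univ_three]
  ring

theorem coeffDet_eq (P Q S : DualPlane) : coeffDet P Q S = det3 P.rep Q.rep S.rep := by
  rw [det3_eq_det, coeffDet]

theorem coeffDet_mk_eq_zero_iff {x y z : Fin 3 → ℂ} (hx : x ≠ 0) (hy : y ≠ 0) (hz : z ≠ 0) :
    coeffDet (.mk ℂ x hx) (.mk ℂ y hy) (.mk ℂ z hz) = 0 ↔ det3 x y z = 0 := by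
  obtain ⟨a, ha⟩ := Projectivization.exists_smul_eq_mk_rep ℂ x hx
  obtain ⟨b, hb⟩ := Projectivization.exists_smul_eq_mk_rep ℂ y hy
  obtain ⟨c, hc⟩ := Projectivization.exists_smul_eq_mk_rep ℂ z hz
  rw [coeffDet_eq, ← ha, ← hb, ← hc, Units.smul_def, Units.smul_def, Units.smul_def, det3_smul]
  simp

theorem mem_line_iff (P x : ℙ ℂ (Fin 3 → ℂ)) : x ∈ line P ↔ P.rep ⬝ᵥ x.rep = 0 := by
  conv_lhs => rw [line, Set.mem_ofPred_eq, ← P.mk_rep, ← x.mk_rep, Projectivization.orthogonal_mk]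

/-- A common point of three lines is a nonzero kernel vector of their coefficient matrix. -/
theorem concurrent_iff (P Q S : DualPlane) :
    (line P ∩ line Q ∩ line S).Nonempty ↔ coeffDet P Q S = 0 := by
  rw [coeffDet, ← Matrix.exists_mulVec_eq_zero_iff]
  constructor
  · rintro ⟨x, ⟨hP, hQ⟩, hS⟩
    rw [mem_line_iff] at hP hQ hS
    refine ⟨x.rep, x.rep_nonzero, ?_⟩
    ext i
    fin_cases i
    · exact hP
    · exact hQ
    · exact hS
  · rintro ⟨v, hv, h⟩
    have hl : ∀ T : DualPlane, T.rep ⬝ᵥ v = 0 → .mk ℂ v hv ∈ line T := by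
      intro T hT
      rw [line, Set.mem_ofPred_eq, ← T.mk_rep, Projectivization.orthogonal_mk]
      exact hT
    exact ⟨.mk ℂ v hv, ⟨hl P (congrFun h 0), hl Q (congrFun h 1)⟩, hl S (congrFun h 2)⟩

theorem not_concurrent_iff (P Q S : DualPlane) :
    line P ∩ line Q ∩ line S = ∅ ↔ coeffDet P Q S ≠ 0 := by
  rw [← Set.not_nonempty_iff_eq_empty, concurrent_iff]

variable {n : ℕ}

theorem mem_totalSet_iff {A P : Fin n → DualPlane} :
    P ∈ totalSet A ↔ Function.Injective P ∧
      ∀ i j k, coeffDet (A i) (A j) (A k) = 0 ↔ coeffDet (P i) (P j) (P k) = 0 := by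
  simp only [totalSet, Set.mem_ofPred_eq, concurrent_iff, not_concurrent_iff]
  refine and_congr_right fun _ => forall₃_congr fun i j k => ?_
  tauto

theorem mem_totalSet_self {A : Fin n → DualPlane} (hA : Function.Injective A) :
    A ∈ totalSet A :=
  mem_totalSet_iff.2 ⟨hA, fun _ _ _ => Iff.rfl⟩

theorem coeffDet_self_left (P Q : DualPlane) : coeffDet P P Q = 0 := by
  rw [coeffDet_eq, det3]; ring

end Det

/-! ### Irreducibility from a chart -/

section Chart

open MvPolynomial

variable {n m : ℕ}

/-- The value at `u` of a vector of polynomials. -/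
noncomputable def evalVec (u : Fin m → ℂ) (x : Fin 3 → MvPolynomial (Fin m) ℂ) : Fin 3 → ℂ :=
  fun j => eval u (x j)

theorem eval_det3 (u : Fin m → ℂ) (x y z : Fin 3 → MvPolynomial (Fin m) ℂ) :
    eval u (det3 x y z) = det3 (evalVec u x) (evalVec u y) (evalVec u z) := by
  simp [det3, evalVec]

/-- The vectors `x` and `y` are nonzero multiples of each other. -/
def Proportional (x y : Fin 3 → ℂ) : Prop := ∃ c : ℂ, c ≠ 0 ∧ y = c • x

/-- Hilbert's Nullstellensatz: a polynomial that vanishes on the zero set of a prime ideal belongs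
to it. -/
theorem exists_eval_ne_zero {f F : MvPolynomial (Fin m) ℂ} (hf : (Ideal.span {f}).IsPrime)
    (hF : F ∉ Ideal.span {f}) : ∃ u, eval u f = 0 ∧ eval u F ≠ 0 := by
  by_contra! h
  apply hF
  rw [← IsPrime.vanishingIdeal_zeroLocus (k := ℂ) (K := ℂ) (Ideal.span {f}), mem_vanishingIdeal_iff]
  intro u hu
  rw [zeroLocus_span] at hu
  have := h u (by simpa [aeval_eq_eval] using hu)
  simpa [aeval_eq_eval] using this

theorem notMem_span_of_eval_ne_zero {f F : MvPolynomial (Fin m) ℂ} {u : Fin m → ℂ}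
    (hf : eval u f = 0) (hF : eval u F ≠ 0) : F ∉ Ideal.span {f} := by
  rw [Ideal.mem_span_singleton]
  rintro ⟨q, rfl⟩
  simp [hf] at hF

/-- The chart need not be injective, and its values need not all lie in the total space: it suffices
that every class is hit and that the bad parameters are cut out by determinants. `hpair` makes these
determinants control everything, since their nonvanishing forces the vectors to be nonzero and to
represent distinct points. -/
theorem irreducibleSpace_moduliSpace_of_chart [Nontrivial (Fin n)] {A : Fin n → DualPlane}
    (hA : Function.Injective A)
    (φ : Fin n → Fin 3 → MvPolynomial (Fin m) ℂ) (f : MvPolynomial (Fin m) ℂ)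
    (hf : (Ideal.span {f}).IsPrime)
    (hzero : ∀ u, eval u f = 0 → ∀ i j k, coeffDet (A i) (A j) (A k) = 0 →
      det3 (evalVec u (φ i)) (evalVec u (φ j)) (evalVec u (φ k)) = 0)
    (hpair : ∀ i j, i ≠ j → ∃ k, coeffDet (A i) (A j) (A k) ≠ 0)
    (hchart : ∀ P ∈ totalSet A, ∃ u, eval u f = 0 ∧ ∃ g : Matrix.GeneralLinearGroup (Fin 3) ℂ,
      ∀ i, Proportional (g.1.mulVec (P i).rep) (evalVec u (φ i))) :
    IrreducibleSpace (ModuliSpace A) := by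
  classical
  -- points of the chart at which the required determinants do not vanish
  have hgood : ∀ u, eval u f = 0 → (∀ i j k, coeffDet (A i) (A j) (A k) ≠ 0 →
      det3 (evalVec u (φ i)) (evalVec u (φ j)) (evalVec u (φ k)) ≠ 0) →
      ∃ hx : ∀ i, evalVec u (φ i) ≠ 0,
        (fun i => Projectivization.mk ℂ (evalVec u (φ i)) (hx i)) ∈ totalSet A := by
    intro u hu h
    have hx : ∀ i, evalVec u (φ i) ≠ 0 := by
      intro i h0
      obtain ⟨j, hj⟩ := exists_ne i
      obtain ⟨k, hk⟩ := hpair i j hj.symm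
      apply h i j k hk
      simp [det3, h0]
    refine ⟨hx, mem_totalSet_iff.2 ⟨?_, fun i j k => ?_⟩⟩
    · intro i j hij
      by_contra hne
      obtain ⟨k, hk⟩ := hpair i j hne
      apply h i j k hk
      rw [← coeffDet_mk_eq_zero_iff (hx i) (hx j) (hx k)]
      simp only at hij
      rw [hij, coeffDet_self_left]
    · rw [coeffDet_mk_eq_zero_iff]
      exact ⟨hzero u hu i j k, fun h' => by_contra fun h0 => h i j k h0 h'⟩
  have hrep : ∀ P : TotalSpace A, ∃ u, eval u f = 0 ∧
      (∀ i j k, coeffDet (A i) (A j) (A k) ≠ 0 →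
        det3 (evalVec u (φ i)) (evalVec u (φ j)) (evalVec u (φ k)) ≠ 0) ∧
      ∀ (hx : ∀ i, evalVec u (φ i) ≠ 0)
        (ht : (fun i => Projectivization.mk ℂ (evalVec u (φ i)) (hx i)) ∈ totalSet A),
        (Quot.mk (ProjEquiv A) P : Quot (ProjEquiv A)) = Quot.mk _ ⟨_, ht⟩ := by
    intro P
    obtain ⟨u, hu, g, hg⟩ := hchart P.1 P.2
    choose c hc hcg using hg
    refine ⟨u, hu, fun i j k h => ?_, fun hx ht => Quot.sound ⟨.mk g, fun i => ?_⟩⟩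
    · have h' : coeffDet (P.1 i) (P.1 j) (P.1 k) ≠ 0 := fun h0 =>
        h (((mem_totalSet_iff.1 P.2).2 i j k).2 h0)
      rw [coeffDet_eq] at h'
      rw [hcg, hcg, hcg, det3_smul, det3_mulVec]
      have hgdet : g.1.det ≠ 0 := by
        have := g.isUnit
        rw [Matrix.isUnit_iff_isUnit_det] at this
        exact this.ne_zero
      have := hc i
      have := hc j
      have := hc k
      positivity
    · rw [← (P.1 i).mk_rep, Projectivization.PGL.mk_smul_mk, Projectivization.mk_eq_mk_iff']
      refine ⟨c i, ?_⟩
      simp only [hcg]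
      rfl
  -- It remains to show that any two nonempty open sets `U`, `V` meet. Each is replaced by a basic
  -- open set around a point of the chart.
  refine @IrreducibleSpace.mk _ _ ⟨?_⟩ ⟨Quot.mk _ ⟨A, mem_totalSet_self hA⟩⟩
  rintro U V hU hV ⟨p, -, hpU⟩ ⟨q, -, hqV⟩
  induction p using Quot.ind with | mk P =>
  induction q using Quot.ind with | mk Q =>
  obtain ⟨U', hU', hUU'⟩ : ∃ U', IsOpen[zariskiTopology n] U' ∧
      Subtype.val ⁻¹' U' = (Quot.mk (ProjEquiv A)) ⁻¹' U := hU
  obtain ⟨V', hV', hVV'⟩ : ∃ V', IsOpen[zariskiTopology n] V' ∧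
      Subtype.val ⁻¹' V' = (Quot.mk (ProjEquiv A)) ⁻¹' V := hV
  obtain ⟨u, hu, hdu, hPu⟩ := hrep P
  obtain ⟨v, hv, hdv, hQv⟩ := hrep Q
  obtain ⟨hxu, htu⟩ := hgood u hu hdu
  obtain ⟨hxv, htv⟩ := hgood v hv hdv
  have hUmem : ∀ T : TotalSpace A, T.1 ∈ U' ↔ Quot.mk (ProjEquiv A) T ∈ U := fun T =>
    Set.ext_iff.1 hUU' T
  have hVmem : ∀ T : TotalSpace A, T.1 ∈ V' ↔ Quot.mk (ProjEquiv A) T ∈ V := fun T =>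
    Set.ext_iff.1 hVV' T
  obtain ⟨F, hF, hFu, hFU⟩ := exists_nonvanishing_subset hU'
    ((hUmem ⟨_, htu⟩).2 (by rw [← hPu hxu htu]; exact hpU))
  obtain ⟨G, hG, hGv, hGV⟩ := exists_nonvanishing_subset hV'
    ((hVmem ⟨_, htv⟩).2 (by rw [← hQv hxv htv]; exact hqV))
  rw [mem_nonvanishing_iff hF] at hFu
  rw [mem_nonvanishing_iff hG] at hGv
  let pull : MvPolynomial (Fin n × Fin 3) ℂ → MvPolynomial (Fin m) ℂ :=
    fun F => bind₁ (fun p : Fin n × Fin 3 => φ p.1 p.2) F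
  have hpull : ∀ (w : Fin m → ℂ) F, eval w (pull F) =
      eval (fun p : Fin n × Fin 3 => evalVec w (φ p.1) p.2) F := by
    intro w F
    simp only [pull, eval, eval₂Hom_bind₁]
    rfl
  -- `H` is nonzero exactly at the parameters whose tuple lies in the total space, among the zeros
  -- of `f`.
  let H : MvPolynomial (Fin m) ℂ := ∏ t : Fin n × Fin n × Fin n,
    if coeffDet (A t.1) (A t.2.1) (A t.2.2) = 0 then 1 else det3 (φ t.1) (φ t.2.1) (φ t.2.2)
  have hH : ∀ w : Fin m → ℂ, eval w H ≠ 0 ↔ ∀ i j k, coeffDet (A i) (A j) (A k) ≠ 0 →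
      det3 (evalVec w (φ i)) (evalVec w (φ j)) (evalVec w (φ k)) ≠ 0 := by
    intro w
    simp only [H, map_prod, Finset.prod_ne_zero_iff, Finset.mem_univ, true_imp_iff, Prod.forall]
    refine forall₃_congr fun i j k => ?_
    split_ifs with h
    · simp [h]
    · rw [eval_det3]
      tauto
  -- None of the three factors is in the prime ideal: each is nonzero at `u` or at `v`. A zero `w`
  -- of `f` where the product is nonzero then gives a point of `U ∩ V`.
  have hmem : pull F * pull G * H ∉ Ideal.span {f} := by
    intro h
    rcases hf.mem_or_mem h with h | h
    · rcases hf.mem_or_mem h with h | h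
      · exact notMem_span_of_eval_ne_zero hu (by rw [hpull]; exact hFu) h
      · exact notMem_span_of_eval_ne_zero hv (by rw [hpull]; exact hGv) h
    · exact notMem_span_of_eval_ne_zero hu ((hH u).2 hdu) h
  obtain ⟨w, hw, hne⟩ := exists_eval_ne_zero hf hmem
  rw [map_mul, map_mul, hpull, hpull, mul_ne_zero_iff, mul_ne_zero_iff] at hne
  obtain ⟨⟨hFw, hGw⟩, hHw⟩ := hne
  obtain ⟨hxw, htw⟩ := hgood w hw ((hH w).1 hHw)
  refine ⟨Quot.mk _ ⟨_, htw⟩, Set.mem_univ _, (hUmem ⟨_, htw⟩).1 (hFU ?_),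
    (hVmem ⟨_, htw⟩).1 (hGV ?_)⟩
  · rw [mem_nonvanishing_iff hF]
    exact hFw
  · rw [mem_nonvanishing_iff hG]
    exact hGw

end Chart

/-! ### Vectors up to scaling -/

section Proportional

variable {x y z x' y' z' : Fin 3 → ℂ}

theorem Proportional.refl (x : Fin 3 → ℂ) : Proportional x x := ⟨1, one_ne_zero, by simp⟩

theorem Proportional.det3_eq_zero_iff (hx : Proportional x x') (hy : Proportional y y')
    (hz : Proportional z z') : det3 x y z = 0 ↔ det3 x' y' z' = 0 := by
  obtain ⟨a, ha, rfl⟩ := hx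
  obtain ⟨b, hb, rfl⟩ := hy
  obtain ⟨c, hc, rfl⟩ := hz
  rw [det3_smul]
  simp [ha, hb, hc]

/-- Cramer's rule, with a nonzero coordinate of the cross product as denominator. -/
theorem exists_smul_add_smul_eq (h : crossProduct x y ≠ 0) (hd : det3 x y z = 0) :
    ∃ s t : ℂ, z = s • x + t • y := by
  have hd' := hd
  rw [det3] at hd'
  have h' : x 1 * y 2 - x 2 * y 1 ≠ 0 ∨ x 2 * y 0 - x 0 * y 2 ≠ 0 ∨ x 0 * y 1 - x 1 * y 0 ≠ 0 := by
    by_contra! h0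
    apply h
    rw [cross_apply, h0.1, h0.2.1, h0.2.2]
    simp
  rcases h' with h' | h' | h'
  · obtain ⟨D, hD⟩ : ∃ D, D = x 1 * y 2 - x 2 * y 1 := ⟨_, rfl⟩
    rw [← hD] at h'
    refine ⟨(z 1 * y 2 - z 2 * y 1) / D, (x 1 * z 2 - x 2 * z 1) / D, ?_⟩
    ext i
    fin_cases i <;> simp <;> field_simp <;> rw [hD]
    · linear_combination hd'
    · ring
    · ring
  · obtain ⟨D, hD⟩ : ∃ D, D = x 2 * y 0 - x 0 * y 2 := ⟨_, rfl⟩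
    rw [← hD] at h'
    refine ⟨(z 2 * y 0 - z 0 * y 2) / D, (x 2 * z 0 - x 0 * z 2) / D, ?_⟩
    ext i
    fin_cases i <;> simp <;> field_simp <;> rw [hD]
    · ring
    · linear_combination hd'
    · ring
  · obtain ⟨D, hD⟩ : ∃ D, D = x 0 * y 1 - x 1 * y 0 := ⟨_, rfl⟩
    rw [← hD] at h'
    refine ⟨(z 0 * y 1 - z 1 * y 0) / D, (x 0 * z 1 - x 1 * z 0) / D, ?_⟩
    ext i
    fin_cases i <;> simp <;> field_simp <;> rw [hD]
    · ring
    · ring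
    · linear_combination hd'

theorem Proportional.congr {a0 a1 a2 b0 b1 b2 : ℂ} (h : Proportional x ![a0, a1, a2])
    (h0 : a0 = b0) (h1 : a1 = b1) (h2 : a2 = b2) : Proportional x ![b0, b1, b2] := by
  rwa [← h0, ← h1, ← h2]

/-- A point on the line through `x` and `y`, other than `y`. -/
theorem exists_proportional_add {a0 a1 a2 b0 b1 b2 : ℂ} (hx : Proportional x ![a0, a1, a2])
    (hy : Proportional y ![b0, b1, b2]) (h : det3 x y z = 0) (hxy : crossProduct x y ≠ 0)
    (hyz : crossProduct y z ≠ 0) :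
    ∃ t, Proportional z ![a0 + t * b0, a1 + t * b1, a2 + t * b2] := by
  obtain ⟨s, t, rfl⟩ := exists_smul_add_smul_eq hxy h
  have hs : s ≠ 0 := by
    rintro rfl
    simp at hyz
  obtain ⟨a, ha, hxa⟩ := hx
  obtain ⟨b, hb, hyb⟩ := hy
  refine ⟨t * a / (s * b), a / s, div_ne_zero ha hs, ?_⟩
  have e0 := congrFun hxa 0
  have e1 := congrFun hxa 1
  have e2 := congrFun hxa 2
  have f0 := congrFun hyb 0
  have f1 := congrFun hyb 1
  have f2 := congrFun hyb 2
  simp at e0 e1 e2 f0 f1 f2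
  ext i
  fin_cases i <;> simp [e0, e1, e2, f0, f1, f2] <;> field_simp

/-- The intersection point of the lines through `x, y` and through `x', y'`. -/
theorem Proportional.of_meet {a0 a1 a2 b0 b1 b2 c0 c1 c2 d0 d1 d2 : ℂ}
    (hx : Proportional x ![a0, a1, a2]) (hy : Proportional y ![b0, b1, b2])
    (hx' : Proportional x' ![c0, c1, c2]) (hy' : Proportional y' ![d0, d1, d2])
    (h : det3 x y z = 0) (h' : det3 x' y' z = 0) (hne : det3 x y x' ≠ 0)
    (hcd : crossProduct x' y' ≠ 0) (hz : z ≠ 0) (k r0 r1 r2 : ℂ)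
    (e0 : k * r0 = (a0 * (b1 * d2 - b2 * d1) - a1 * (b0 * d2 - b2 * d0) +
      a2 * (b0 * d1 - b1 * d0)) * c0 - (a0 * (b1 * c2 - b2 * c1) - a1 * (b0 * c2 - b2 * c0) +
      a2 * (b0 * c1 - b1 * c0)) * d0)
    (e1 : k * r1 = (a0 * (b1 * d2 - b2 * d1) - a1 * (b0 * d2 - b2 * d0) +
      a2 * (b0 * d1 - b1 * d0)) * c1 - (a0 * (b1 * c2 - b2 * c1) - a1 * (b0 * c2 - b2 * c0) +
      a2 * (b0 * c1 - b1 * c0)) * d1)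
    (e2 : k * r2 = (a0 * (b1 * d2 - b2 * d1) - a1 * (b0 * d2 - b2 * d0) +
      a2 * (b0 * d1 - b1 * d0)) * c2 - (a0 * (b1 * c2 - b2 * c1) - a1 * (b0 * c2 - b2 * c0) +
      a2 * (b0 * c1 - b1 * c0)) * d2) :
    Proportional z ![r0, r1, r2] := by
  obtain ⟨p, q, rfl⟩ := exists_smul_add_smul_eq hcd h'
  obtain ⟨a, ha, hxa⟩ := hx
  obtain ⟨b, hb, hyb⟩ := hy
  obtain ⟨c, hc, hxc⟩ := hx'
  obtain ⟨d, hd, hyd⟩ := hy'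
  have ha0 := congrFun hxa 0
  have ha1 := congrFun hxa 1
  have ha2 := congrFun hxa 2
  have hb0 := congrFun hyb 0
  have hb1 := congrFun hyb 1
  have hb2 := congrFun hyb 2
  have hc0 := congrFun hxc 0
  have hc1 := congrFun hxc 1
  have hc2 := congrFun hxc 2
  have hd0 := congrFun hyd 0
  have hd1 := congrFun hyd 1
  have hd2 := congrFun hyd 2
  simp at ha0 ha1 ha2 hb0 hb1 hb2 hc0 hc1 hc2 hd0 hd1 hd2
  subst ha0 ha1 ha2 hb0 hb1 hb2 hc0 hc1 hc2 hd0 hd1 hd2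
  -- As `z = p x' + q y'` lies on the line through `x` and `y`, the ratio of `p` and `q` is
  -- determined by `D` and `E`, and `z` is a multiple of `E x' - D y'`.
  have hrel : p * det3 x y x' + q * det3 x y y' = 0 := by
    rw [← h]
    simp [det3]
    ring
  have hq : q ≠ 0 := by
    rintro rfl
    simp [hne] at hrel
    simp [hrel] at hz
  set D := det3 x y x' with hD
  set E := det3 x y y' with hE
  rw [det3] at hD hE
  have hv : ∀ i, k * ![r0, r1, r2] i = a * b * c * d * (E * x' i - D * y' i) := by
    intro i
    rw [hD, hE]
    fin_cases i <;> simp [e0, e1, e2] <;> ring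
  -- The factor `k` need not be assumed nonzero: if it vanished, then `E x' = D y'`, which forces `z
  -- = 0`.
  have hk : k ≠ 0 := by
    rintro rfl
    apply hz
    have hv' : ∀ i, E * x' i = D * y' i := by
      intro i
      have := hv i
      simp [ha, hb, hc, hd] at this
      linear_combination this
    ext i
    simp only [Pi.add_apply, Pi.smul_apply, smul_eq_mul, Pi.zero_apply]
    apply mul_left_cancel₀ hne
    linear_combination x' i * hrel - q * hv' i
  have hp : p = -q * E / D := by
    field_simp
    linear_combination hrel
  refine ⟨-(a * b * c * d * D) / (q * k), by
    simp only [ne_eq, div_eq_zero_iff, neg_eq_zero, mul_eq_zero, not_or]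
    tauto, ?_⟩
  ext i
  apply mul_left_cancel₀ hk
  rw [hv i]
  simp only [Pi.smul_apply, Pi.add_apply, smul_eq_mul, hp]
  field_simp
  ring

theorem Proportional.det_eq_zero {a0 a1 a2 b0 b1 b2 c0 c1 c2 : ℂ}
    (hx : Proportional x ![a0, a1, a2]) (hy : Proportional y ![b0, b1, b2])
    (hz : Proportional z ![c0, c1, c2]) (h : det3 x y z = 0) :
    a0 * (b1 * c2 - b2 * c1) - a1 * (b0 * c2 - b2 * c0) + a2 * (b0 * c1 - b1 * c0) = 0 := by
  simpa [det3] using (hx.det3_eq_zero_iff hy hz).1 h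

theorem Proportional.det_ne_zero {a0 a1 a2 b0 b1 b2 c0 c1 c2 : ℂ}
    (hx : Proportional x ![a0, a1, a2]) (hy : Proportional y ![b0, b1, b2])
    (hz : Proportional z ![c0, c1, c2]) (h : det3 x y z ≠ 0) :
    a0 * (b1 * c2 - b2 * c1) - a1 * (b0 * c2 - b2 * c0) + a2 * (b0 * c1 - b1 * c0) ≠ 0 := by
  simpa [det3] using (hx.det3_eq_zero_iff hy hz).not.1 h

theorem exists_proportional_one (hx : Proportional x ![1, 0, 0]) (hy : Proportional y ![0, 1, 0])
    (h : det3 x y z ≠ 0) : ∃ a b, Proportional z ![a, b, 1] := by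
  rw [ne_eq, hx.det3_eq_zero_iff hy (.refl z)] at h
  simp [det3] at h
  refine ⟨z 0 / z 2, z 1 / z 2, (z 2)⁻¹, inv_ne_zero h, ?_⟩
  ext i
  fin_cases i <;> simp [h] <;> ring

/-- Four vectors in general position become the standard frame. -/
theorem exists_standard_frame {x y z t : Fin 3 → ℂ} (hxyz : det3 x y z ≠ 0)
    (hxyt : det3 x y t ≠ 0) (hxzt : det3 x z t ≠ 0) (hyzt : det3 y z t ≠ 0) :
    ∃ g : Matrix.GeneralLinearGroup (Fin 3) ℂ, Proportional (g.1.mulVec x) ![1, 0, 0] ∧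
      Proportional (g.1.mulVec y) ![0, 1, 0] ∧ Proportional (g.1.mulVec z) ![0, 0, 1] ∧
      Proportional (g.1.mulVec t) ![1, 1, 1] := by
  -- By Cramer's rule the columns of `N` are multiples of `x`, `y`, `z` with sum `det3 x y z • t`.
  -- So `N` carries the standard frame to the given vectors, and its inverse is the transformation
  -- sought.
  let N : Matrix (Fin 3) (Fin 3) ℂ :=
    (Matrix.of ![det3 y z t • x, -det3 x z t • y, det3 x y t • z]).transpose
  have hN : IsUnit N.det := by
    rw [isUnit_iff_ne_zero, Matrix.det_transpose, ← det3_eq_det, det3_smul]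
    simp [hxyz, hxyt, hxzt, hyzt]
  have key : ∀ v s : Fin 3 → ℂ, ∀ c : ℂ, c ≠ 0 → N.mulVec s = c • v →
      Proportional (N⁻¹.mulVec v) s := by
    intro v s c hc h
    refine ⟨c, hc, ?_⟩
    rw [← Matrix.mulVec_smul, ← h, Matrix.mulVec_mulVec, Matrix.nonsing_inv_mul _ hN,
      Matrix.one_mulVec]
  refine ⟨Matrix.GeneralLinearGroup.mk'' N⁻¹ (by
    rw [Matrix.det_nonsing_inv]
    exact hN.ringInverse), key _ _ _ hyzt ?_, key _ _ _ (neg_ne_zero.2 hxzt) ?_, key _ _ _ hxyt ?_,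
    key _ _ _ hxyz ?_⟩
  all_goals
    ext i
    fin_cases i <;>
      simp [N, Matrix.mulVec, dotProduct, Fin.sum_univ_three, Matrix.of_apply]
  all_goals simp only [det3]; ring

end Proportional

/-! ### Realizations of configuration tables -/

section Realization

variable {n : ℕ}

/-- The columns `i`, `j`, `k` share a point. -/
def Shares (C : ConfigurationTable n) (i j k : Fin n) : Prop :=
  (C i ∩ C j ∩ C k).Nonempty

instance (C : ConfigurationTable n) (i j k : Fin n) : Decidable (Shares C i j k) :=
  inferInstanceAs (Decidable (C i ∩ C j ∩ C k).Nonempty)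

theorem shares_iff {C : ConfigurationTable n} {i j k : Fin n} :
    Shares C i j k ↔ ∃ e, e ∈ C i ∧ e ∈ C j ∧ e ∈ C k := by
  simp [Shares, Finset.Nonempty]

/-- The vectors `w` are pairwise independent, and three of them are dependent exactly when the
columns of `C` share a point. -/
structure IsRealization (C : ConfigurationTable n) (w : Fin n → Fin 3 → ℂ) : Prop where
  det_eq_zero_iff : ∀ i j k, i ≠ j → i ≠ k → j ≠ k → (det3 (w i) (w j) (w k) = 0 ↔ Shares C i j k)
  cross_ne_zero : ∀ i j, i ≠ j → crossProduct (w i) (w j) ≠ 0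

variable {C : ConfigurationTable n} {w : Fin n → Fin 3 → ℂ}

theorem IsRealization.det_eq_zero (hw : IsRealization C w) {i j k : Fin n}
    (h : (i ≠ j ∧ i ≠ k ∧ j ≠ k) ∧ Shares C i j k) : det3 (w i) (w j) (w k) = 0 :=
  (hw.det_eq_zero_iff i j k h.1.1 h.1.2.1 h.1.2.2).2 h.2

theorem IsRealization.det_ne_zero (hw : IsRealization C w) {i j k : Fin n}
    (h : (i ≠ j ∧ i ≠ k ∧ j ≠ k) ∧ ¬ Shares C i j k) : det3 (w i) (w j) (w k) ≠ 0 :=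
  (hw.det_eq_zero_iff i j k h.1.1 h.1.2.1 h.1.2.2).not.2 h.2

theorem IsRealization.ne_zero [Nontrivial (Fin n)] (hw : IsRealization C w) (i : Fin n) :
    w i ≠ 0 := by
  obtain ⟨j, hj⟩ := exists_ne i
  intro h
  apply hw.cross_ne_zero i j hj.symm
  simp [h]

theorem crossProduct_mulVec_ne_zero (g : Matrix.GeneralLinearGroup (Fin 3) ℂ) {x y : Fin 3 → ℂ}
    (h : crossProduct x y ≠ 0) : crossProduct (g.1.mulVec x) (g.1.mulVec y) ≠ 0 := by
  rw [crossProduct_ne_zero_iff_linearIndependent] at h ⊢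
  have := h.map' g.1.mulVecLin (LinearMap.ker_eq_bot.2 (by
    rw [Matrix.coe_mulVecLin]
    exact Matrix.mulVec_injective_of_isUnit g.isUnit))
  have e : ![g.1.mulVec x, g.1.mulVec y] = g.1.mulVecLin ∘ ![x, y] := by
    ext i
    fin_cases i <;> rfl
  rw [e]
  exact this

theorem IsRealization.mulVec (hw : IsRealization C w)
    (g : Matrix.GeneralLinearGroup (Fin 3) ℂ) : IsRealization C fun i => g.1.mulVec (w i) := by
  have hg : g.1.det ≠ 0 := by
    have := g.isUnit
    rw [Matrix.isUnit_iff_isUnit_det] at this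
    exact this.ne_zero
  refine ⟨fun i j k hij hik hjk => ?_, fun i j hij => ?_⟩
  · rw [det3_mulVec, ← hw.det_eq_zero_iff i j k hij hik hjk]
    simp [hg]
  · exact crossProduct_mulVec_ne_zero g (hw.cross_ne_zero i j hij)

/-- The standard frame for the lines with four given labels. -/
theorem IsRealization.exists_frame (hw : IsRealization C w) {i j k l : Fin n}
    (h : ((i ≠ j ∧ i ≠ k ∧ j ≠ k) ∧ ¬ Shares C i j k) ∧
      ((i ≠ j ∧ i ≠ l ∧ j ≠ l) ∧ ¬ Shares C i j l) ∧
      ((i ≠ k ∧ i ≠ l ∧ k ≠ l) ∧ ¬ Shares C i k l) ∧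
      ((j ≠ k ∧ j ≠ l ∧ k ≠ l) ∧ ¬ Shares C j k l)) :
    ∃ (g : Matrix.GeneralLinearGroup (Fin 3) ℂ) (v : Fin n → Fin 3 → ℂ),
      (∀ i, v i = g.1.mulVec (w i)) ∧ IsRealization C v ∧
      Proportional (v i) ![1, 0, 0] ∧ Proportional (v j) ![0, 1, 0] ∧
      Proportional (v k) ![0, 0, 1] ∧ Proportional (v l) ![1, 1, 1] := by
  obtain ⟨g, hg⟩ := exists_standard_frame (hw.det_ne_zero h.1) (hw.det_ne_zero h.2.1)
    (hw.det_ne_zero h.2.2.1) (hw.det_ne_zero h.2.2.2)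
  exact ⟨g, _, fun _ => rfl, hw.mulVec g, hg⟩

end Realization

/-! ### Building a realization vector by vector -/

section Realization

variable {n : ℕ} {C : ConfigurationTable n} {v : Fin n → Fin 3 → ℂ}

/-- A line through one intersection point already constructed costs one parameter. -/
theorem IsRealization.join (hv : IsRealization C v) {i j : Fin n} {a0 a1 a2 b0 b1 b2 : ℂ}
    (hi : Proportional (v i) ![a0, a1, a2]) (hj : Proportional (v j) ![b0, b1, b2]) (k : Fin n)
    (h : (i ≠ j ∧ i ≠ k ∧ j ≠ k) ∧ Shares C i j k) :
    ∃ t, Proportional (v k) ![a0 + t * b0, a1 + t * b1, a2 + t * b2] :=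
  exists_proportional_add hi hj (hv.det_eq_zero h) (hv.cross_ne_zero _ _ h.1.1)
    (hv.cross_ne_zero _ _ h.1.2.2)

/-- A line through two intersection points already constructed costs no parameter. The right-hand
sides are the coordinates of `det(a,b,d) c - det(a,b,c) d`, and `r` is a common factor to be removed
from them. -/
theorem IsRealization.meet (hv : IsRealization C v) {i j k l m : Fin n}
    {a0 a1 a2 b0 b1 b2 c0 c1 c2 d0 d1 d2 : ℂ}
    (hi : Proportional (v i) ![a0, a1, a2]) (hj : Proportional (v j) ![b0, b1, b2])
    (hk : Proportional (v k) ![c0, c1, c2]) (hl : Proportional (v l) ![d0, d1, d2])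
    (h : ((i ≠ j ∧ i ≠ m ∧ j ≠ m) ∧ Shares C i j m) ∧ ((k ≠ l ∧ k ≠ m ∧ l ≠ m) ∧ Shares C k l m) ∧
      ((i ≠ j ∧ i ≠ k ∧ j ≠ k) ∧ ¬ Shares C i j k)) (r r0 r1 r2 : ℂ)
    (e0 : r * r0 = (a0 * (b1 * d2 - b2 * d1) - a1 * (b0 * d2 - b2 * d0) +
      a2 * (b0 * d1 - b1 * d0)) * c0 - (a0 * (b1 * c2 - b2 * c1) - a1 * (b0 * c2 - b2 * c0) +
      a2 * (b0 * c1 - b1 * c0)) * d0)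
    (e1 : r * r1 = (a0 * (b1 * d2 - b2 * d1) - a1 * (b0 * d2 - b2 * d0) +
      a2 * (b0 * d1 - b1 * d0)) * c1 - (a0 * (b1 * c2 - b2 * c1) - a1 * (b0 * c2 - b2 * c0) +
      a2 * (b0 * c1 - b1 * c0)) * d1)
    (e2 : r * r2 = (a0 * (b1 * d2 - b2 * d1) - a1 * (b0 * d2 - b2 * d0) +
      a2 * (b0 * d1 - b1 * d0)) * c2 - (a0 * (b1 * c2 - b2 * c1) - a1 * (b0 * c2 - b2 * c0) +
      a2 * (b0 * c1 - b1 * c0)) * d2) :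
    Proportional (v m) ![r0, r1, r2] := by
  have : Nontrivial (Fin n) := ⟨i, j, h.1.1.1⟩
  exact hi.of_meet hj hk hl (hv.det_eq_zero h.1) (hv.det_eq_zero h.2.1) (hv.det_ne_zero h.2.2)
    (hv.cross_ne_zero _ _ h.2.1.1.1) (hv.ne_zero _) r r0 r1 r2 e0 e1 e2

/-- For cancelling factors: a divisor of the determinant of a non-concurrent triple is nonzero. -/
theorem IsRealization.ne_zero_of_dvd (hv : IsRealization C v) {i j k : Fin n}
    {a0 a1 a2 b0 b1 b2 c0 c1 c2 : ℂ}
    (hi : Proportional (v i) ![a0, a1, a2]) (hj : Proportional (v j) ![b0, b1, b2])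
    (hk : Proportional (v k) ![c0, c1, c2])
    (h : (i ≠ j ∧ i ≠ k ∧ j ≠ k) ∧ ¬ Shares C i j k) {r : ℂ} (q : ℂ)
    (e : r * q = a0 * (b1 * c2 - b2 * c1) - a1 * (b0 * c2 - b2 * c0) + a2 * (b0 * c1 - b1 * c0)) :
    r ≠ 0 :=
  left_ne_zero_of_mul (e ▸ hi.det_ne_zero hj hk (hv.det_ne_zero h))

theorem IsRealization.det_expr (hv : IsRealization C v) {i j k : Fin n}
    {a0 a1 a2 b0 b1 b2 c0 c1 c2 : ℂ}
    (hi : Proportional (v i) ![a0, a1, a2]) (hj : Proportional (v j) ![b0, b1, b2])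
    (hk : Proportional (v k) ![c0, c1, c2])
    (h : (i ≠ j ∧ i ≠ k ∧ j ≠ k) ∧ Shares C i j k) :
    a0 * (b1 * c2 - b2 * c1) - a1 * (b0 * c2 - b2 * c0) + a2 * (b0 * c1 - b1 * c0) = 0 :=
  hi.det_eq_zero hj hk (hv.det_eq_zero h)

open MvPolynomial in
/-- The realizations of `C` are, up to projective transformations, parametrized by an open subset
of an irreducible hypersurface of `ℂ³`, or of `ℂ³` itself. -/
def HasChart (C : ConfigurationTable n) : Prop :=
  ∃ (φ : Fin n → Fin 3 → MvPolynomial (Fin 3) ℂ) (f : MvPolynomial (Fin 3) ℂ),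
    (Ideal.span {f}).IsPrime ∧
    (∀ u, eval u f = 0 → ∀ i j k, i < j → j < k → Shares C i j k →
      det3 (evalVec u (φ i)) (evalVec u (φ j)) (evalVec u (φ k)) = 0) ∧
    ∀ w, IsRealization C w → ∃ u, eval u f = 0 ∧
      ∃ g : Matrix.GeneralLinearGroup (Fin 3) ℂ,
        ∀ i, Proportional (g.1.mulVec (w i)) (evalVec u (φ i))

end Realization

/-! ### Irreducible quadratic hypersurfaces -/

section Quadratic

open MvPolynomial

/-- Eisenstein's criterion at `p`; coprimality of the extreme coefficients makes the polynomial
primitive. -/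
theorem irreducible_quadratic {R : Type*} [CommRing R] [IsDomain R] {A B D p : R} (hp : Prime p)
    (hA : ¬ p ∣ A) (hB : p ∣ B) (hD : p ∣ D) (hD2 : ¬ p ^ 2 ∣ D)
    (h : IsRelPrime A D) :
    Irreducible (Polynomial.C A * Polynomial.X ^ 2 + Polynomial.C B * Polynomial.X +
      Polynomial.C D) := by
  have hA0 : A ≠ 0 := by
    rintro rfl
    simp at hA
  have hdeg := Polynomial.natDegree_quadratic (b := B) (c := D) hA0
  have hlead := Polynomial.leadingCoeff_quadratic (b := B) (c := D) hA0
  have hne : (Polynomial.C A * Polynomial.X ^ 2 + Polynomial.C B * Polynomial.X +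
      Polynomial.C D) ≠ 0 := by
    intro h0
    rw [h0] at hdeg
    simp at hdeg
  have h0 : (Polynomial.C A * Polynomial.X ^ 2 + Polynomial.C B * Polynomial.X +
      Polynomial.C D).coeff 0 = D := by simp
  have h1 : (Polynomial.C A * Polynomial.X ^ 2 + Polynomial.C B * Polynomial.X +
      Polynomial.C D).coeff 1 = B := by simp
  have h2 : (Polynomial.C A * Polynomial.X ^ 2 + Polynomial.C B * Polynomial.X +
      Polynomial.C D).coeff 2 = A := by simp
  refine Polynomial.irreducible_of_eisenstein_criterion (P := Ideal.span {p})
    ((Ideal.span_singleton_prime hp.ne_zero).2 hp) ?_ ?_ ?_ ?_ ?_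
  · rwa [hlead, Ideal.mem_span_singleton]
  · intro n hn
    rw [Polynomial.degree_eq_natDegree hne, hdeg] at hn
    have hn : n < 2 := by exact_mod_cast hn
    rw [Ideal.mem_span_singleton]
    interval_cases n
    · rwa [h0]
    · rwa [h1]
  · rw [Polynomial.degree_eq_natDegree hne, hdeg]
    norm_num
  · rwa [h0, Ideal.span_singleton_pow, Ideal.mem_span_singleton]
  · intro r hr
    rw [Polynomial.C_dvd_iff_dvd_coeff] at hr
    exact h (h2 ▸ hr 2) (h0 ▸ hr 0)

/-- `f` is read as a quadratic polynomial in the variable `X 0` over the polynomials in the other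
two, which get the indices `0` and `1`. Irreducible elements are prime by unique factorization. -/
theorem isPrime_span_of_quadratic {f : MvPolynomial (Fin 3) ℂ} {A B D p : MvPolynomial (Fin 2) ℂ}
    (hf : finSuccEquiv ℂ 2 f = Polynomial.C A * Polynomial.X ^ 2 + Polynomial.C B * Polynomial.X +
      Polynomial.C D) (hp : Irreducible p)
    (hA : ¬ p ∣ A) (hB : p ∣ B) (hD : p ∣ D) (hD2 : ¬ p ^ 2 ∣ D) (h : IsRelPrime A D) :
    (Ideal.span {f}).IsPrime := by
  have hirr := irreducible_quadratic hp.prime hA hB hD hD2 h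
  rw [← hf, MulEquiv.irreducible_iff] at hirr
  exact (Ideal.span_singleton_prime hirr.ne_zero).2 hirr.prime

theorem not_dvd_of_eval {p q : MvPolynomial (Fin 2) ℂ} (u : Fin 2 → ℂ) (hp : eval u p = 0)
    (hq : eval u q ≠ 0) : ¬ p ∣ q := by
  rintro ⟨r, rfl⟩
  simp [hp] at hq

theorem irreducible_X_zero_add_one : Irreducible (X 0 + 1 : MvPolynomial (Fin 2) ℂ) := by
  rw [← MulEquiv.irreducible_iff (finSuccEquiv ℂ 1)]
  have : finSuccEquiv ℂ 1 (X 0 + 1) = Polynomial.X - Polynomial.C (-1) := by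
    simp [finSuccEquiv_X_zero]
  rw [this]
  exact (Polynomial.prime_X_sub_C _).irreducible

theorem irreducible_X_zero_add_X_one : Irreducible (X 0 + X 1 : MvPolynomial (Fin 2) ℂ) := by
  rw [← MulEquiv.irreducible_iff (finSuccEquiv ℂ 1)]
  have : finSuccEquiv ℂ 1 (X 0 + X 1) = Polynomial.X - Polynomial.C (-X 0) := by
    have h1 : finSuccEquiv ℂ 1 (X 1) = Polynomial.C (X 0) := finSuccEquiv_X_succ (j := 0)
    rw [map_add, finSuccEquiv_X_zero, h1]
    simp
  rw [this]
  exact (Polynomial.prime_X_sub_C _).irreducible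

theorem finSuccEquiv_X_one : finSuccEquiv ℂ 2 (X 1) = Polynomial.C (X 0) :=
  finSuccEquiv_X_succ (j := 0)

theorem finSuccEquiv_X_two : finSuccEquiv ℂ 2 (X 2) = Polynomial.C (X 1) :=
  finSuccEquiv_X_succ (j := 1)

theorem isRelPrime_of_eval {p q : MvPolynomial (Fin 2) ℂ} (hp : Irreducible p) (u : Fin 2 → ℂ)
    (h : eval u p = 0) (hq : eval u q ≠ 0) : IsRelPrime p q :=
  hp.isRelPrime_iff_not_dvd.2 (not_dvd_of_eval u h hq)

end Quadratic

/-! ### Charts for the ten configuration tables -/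

/-- Homogeneous coordinates for the realizations of `tenThreeTable 0`. -/
def chartOne {R : Type*} [CommRing R] (a b c : R) : Fin 10 → Fin 3 → R :=
  ![![1, 0, 0],
    ![0, 1, 0],
    ![1, a, 0],
    ![0, -a, b],
    ![c, -a + c, c],
    ![c, c, -b + c],
    ![0, 0, 1],
    ![1, 1, 1],
    ![1, 0, b],
    ![c + 1, c, c]]

theorem exists_chartOne {w : Fin 10 → Fin 3 → ℂ} (hw : IsRealization (tenThreeTable 0) w) :
    ∃ (g : Matrix.GeneralLinearGroup (Fin 3) ℂ) (a b c : ℂ), 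
      ∀ i, Proportional (g.1.mulVec (w i)) (chartOne a b c i) := by
  obtain ⟨g, v, hg, hv, h0, h1, h6, h7⟩ :=
    hw.exists_frame (i := 0) (j := 1) (k := 6) (l := 7) (by decide)
  obtain ⟨a, h2⟩ := hv.join h0 h1 2 (by decide)
  replace h2 : Proportional (v 2) ![1, a, 0] := h2.congr (by ring) (by ring) (by ring)
  obtain ⟨b, h8⟩ := hv.join h0 h6 8 (by decide)
  replace h8 : Proportional (v 8) ![1, 0, b] := h8.congr (by ring) (by ring) (by ring)
  have h3 : Proportional (v 3) ![0, -a, b] :=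
    hv.meet h1 h6 h8 h2 (by decide) (1) _ _ _ (by ring) (by ring) (by ring)
  obtain ⟨c, h9⟩ := hv.join h0 h7 9 (by decide)
  replace h9 : Proportional (v 9) ![c + 1, c, c] := h9.congr (by ring) (by ring) (by ring)
  have h4 : Proportional (v 4) ![c, -a + c, c] :=
    hv.meet h1 h7 h9 h2 (by decide) (1) _ _ _ (by ring) (by ring) (by ring)
  have h5 : Proportional (v 5) ![c, c, -b + c] :=
    hv.meet h3 h4 h6 h7 (by decide) (-a) _ _ _ (by ring) (by ring) (by ring)
  refine ⟨g, a, b, c, fun i => ?_⟩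
  rw [← hg]
  fin_cases i <;> assumption

/-- The converse direction of the chart: the incidences are polynomial identities in the parameters.
-/
theorem det3_chartOne_eq_zero {R : Type*} [CommRing R] {a b c : R}
    {i j k : Fin 10} (hij : i < j) (hjk : j < k) (hs : Shares (tenThreeTable 0) i j k) :
    det3 (chartOne a b c i) (chartOne a b c j) (chartOne a b c k) = 0 := by
  have key : (i, j, k) ∈ ([(0, 1, 2), (0, 6, 8), (0, 7, 9), (1, 3, 6), (1, 4, 7),
      (2, 3, 8), (2, 4, 9), (3, 4, 5), (5, 6, 7), (5, 8, 9)] :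
      List (Fin 10 × Fin 10 × Fin 10)) := by
    revert i j k
    decide +kernel
  simp only [List.mem_cons, Prod.mk.injEq, List.not_mem_nil, or_false] at key
  rcases key with ⟨rfl, rfl, rfl⟩ | ⟨rfl, rfl, rfl⟩ | ⟨rfl, rfl, rfl⟩ | ⟨rfl, rfl, rfl⟩ | ⟨rfl,
      rfl, rfl⟩ |
    ⟨rfl, rfl, rfl⟩ | ⟨rfl, rfl, rfl⟩ | ⟨rfl, rfl, rfl⟩ | ⟨rfl, rfl, rfl⟩ | ⟨rfl, rfl, rfl⟩ <;>
    simp [det3, chartOne] <;> ring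

open MvPolynomial in
theorem hasChartOne : HasChart (tenThreeTable 0) := by
  have he : ∀ (u : Fin 3 → ℂ) i, evalVec u (chartOne (X 0) (X 1) (X 2) i) =
      chartOne (u 0) (u 1) (u 2) i := by
    intro u i
    ext j
    fin_cases i <;> fin_cases j <;> simp [evalVec, chartOne]
  refine ⟨chartOne (X 0) (X 1) (X 2), 0, by simpa using Ideal.isPrime_bot,
    fun u _ i j k hij hjk hs => ?_, fun w hw => ?_⟩
  · rw [he, he, he]
    exact det3_chartOne_eq_zero hij hjk hs
  · obtain ⟨g, a, b, c, hg⟩ := exists_chartOne hw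
    exact ⟨![a, b, c], map_zero _, g, fun i => by rw [he]; exact hg i⟩

/-- Homogeneous coordinates for the realizations of `tenThreeTable 1`. -/
def chartTwo {R : Type*} [CommRing R] (a b : R) : Fin 10 → Fin 3 → R :=
  ![![1, 0, 1],
    ![b - 1, b, -a + b],
    ![a, b, 1],
    ![a, b, -a + b],
    ![a, a + 1, 1],
    ![1, 1, 0],
    ![1, 0, 0],
    ![0, 1, 0],
    ![0, 0, 1],
    ![1, 1, 1]]

theorem exists_chartTwo {w : Fin 10 → Fin 3 → ℂ} (hw : IsRealization (tenThreeTable 1) w) :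
    ∃ (g : Matrix.GeneralLinearGroup (Fin 3) ℂ) (a b : ℂ), 
      ∀ i, Proportional (g.1.mulVec (w i)) (chartTwo a b i) := by
  obtain ⟨g, v, hg, hv, h6, h7, h8, h9⟩ :=
    hw.exists_frame (i := 6) (j := 7) (k := 8) (l := 9) (by decide)
  have h0 : Proportional (v 0) ![1, 0, 1] :=
    hv.meet h8 h6 h9 h7 (by decide) (1) _ _ _ (by ring) (by ring) (by ring)
  have h5 : Proportional (v 5) ![1, 1, 0] :=
    hv.meet h6 h7 h8 h9 (by decide) (-1) _ _ _ (by ring) (by ring) (by ring)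
  obtain ⟨a, b, h2⟩ := exists_proportional_one h6 h7 (hv.det_ne_zero (k := 2) (by decide))
  obtain ⟨c, h4⟩ := hv.join h2 h7 4 (by decide)
  replace h4 : Proportional (v 4) ![a, b + c, 1] := h4.congr (by ring) (by ring) (by ring)
  have h1 : Proportional (v 1) ![a - c, b, -c + 1] :=
    hv.meet h0 h2 h9 h4 (by decide) (-a + 1) _ _ _ (by ring) (by ring) (by ring)
  have h3 : Proportional (v 3) ![a, b, -c + 1] :=
    hv.meet h1 h6 h8 h2 (by decide) (b) _ _ _ (by ring) (by ring) (by ring)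
  have k0 : c ≠ 0 :=
    hv.ne_zero_of_dvd h2 h4 h5 (by decide) (-1) (by ring)
  have hd := hv.det_expr h3 h4 h5 (by decide)
  have he : a - b - c + 1 = 0 :=
    (mul_eq_zero.1 (show ((c)) * (a - b - c + 1) = 0 by linear_combination -hd)).resolve_left k0
  obtain rfl : c = a - b + 1 := by linear_combination -he
  refine ⟨g, a, b, fun i => ?_⟩
  rw [← hg]
  fin_cases i
  exacts [h0.congr (by ring) (by ring) (by ring),
    h1.congr (by ring) (by ring) (by ring),
    h2.congr (by ring) (by ring) (by ring),
    h3.congr (by ring) (by ring) (by ring),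
    h4.congr (by ring) (by ring) (by ring),
    h5.congr (by ring) (by ring) (by ring),
    h6.congr (by ring) (by ring) (by ring),
    h7.congr (by ring) (by ring) (by ring),
    h8.congr (by ring) (by ring) (by ring),
    h9.congr (by ring) (by ring) (by ring)]

theorem det3_chartTwo_eq_zero {R : Type*} [CommRing R] {a b : R}
    {i j k : Fin 10} (hij : i < j) (hjk : j < k) (hs : Shares (tenThreeTable 1) i j k) :
    det3 (chartTwo a b i) (chartTwo a b j) (chartTwo a b k) = 0 := by
  have key : (i, j, k) ∈ ([(0, 1, 2), (0, 6, 8), (0, 7, 9), (1, 3, 6), (1, 4, 9),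
      (2, 3, 8), (2, 4, 7), (3, 4, 5), (5, 6, 7), (5, 8, 9)] :
      List (Fin 10 × Fin 10 × Fin 10)) := by
    revert i j k
    decide +kernel
  simp only [List.mem_cons, Prod.mk.injEq, List.not_mem_nil, or_false] at key
  rcases key with ⟨rfl, rfl, rfl⟩ | ⟨rfl, rfl, rfl⟩ | ⟨rfl, rfl, rfl⟩ | ⟨rfl, rfl, rfl⟩ | ⟨rfl,
      rfl, rfl⟩ |
    ⟨rfl, rfl, rfl⟩ | ⟨rfl, rfl, rfl⟩ | ⟨rfl, rfl, rfl⟩ | ⟨rfl, rfl, rfl⟩ | ⟨rfl, rfl, rfl⟩ <;>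
    simp [det3, chartTwo] <;> ring

open MvPolynomial in
theorem hasChartTwo : HasChart (tenThreeTable 1) := by
  have he : ∀ (u : Fin 3 → ℂ) i, evalVec u (chartTwo (X 0) (X 1) i) =
      chartTwo (u 0) (u 1) i := by
    intro u i
    ext j
    fin_cases i <;> fin_cases j <;> simp [evalVec, chartTwo]
  refine ⟨chartTwo (X 0) (X 1), 0, by simpa using Ideal.isPrime_bot,
    fun u _ i j k hij hjk hs => ?_, fun w hw => ?_⟩
  · rw [he, he, he]
    exact det3_chartTwo_eq_zero hij hjk hs
  · obtain ⟨g, a, b, hg⟩ := exists_chartTwo hw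
    -- The chart does not involve the third variable, so any value will do.
    exact ⟨![a, b, 0], map_zero _, g, fun i => by rw [he]; exact hg i⟩

/-- Homogeneous coordinates for the realizations of `tenThreeTable 2`. -/
def chartThree {R : Type*} [CommRing R] (a b : R) : Fin 10 → Fin 3 → R :=
  ![![b + 1, a + b, a + 2 * b + 1],
    ![1, 0, a + b + 1],
    ![a * b + a + b ^ 2 + b, a ^ 2 + 2 * a * b + a + b ^ 2 + b, a ^ 2 + 2 * a * b + a + b ^ 2 + b],
    ![1, 0, 0],
    ![0, 1, 0],
    ![1, 1, 0],
    ![0, 0, 1],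
    ![1, 1, 1],
    ![b + 1, a + b, a + b + 1],
    ![1, a, a + b + 1]]

theorem exists_chartThree {w : Fin 10 → Fin 3 → ℂ} (hw : IsRealization (tenThreeTable 2) w) :
    ∃ (g : Matrix.GeneralLinearGroup (Fin 3) ℂ) (a b : ℂ), 
      ∀ i, Proportional (g.1.mulVec (w i)) (chartThree a b i) := by
  obtain ⟨g, v, hg, hv, h3, h4, h6, h7⟩ :=
    hw.exists_frame (i := 3) (j := 4) (k := 6) (l := 7) (by decide)
  have h5 : Proportional (v 5) ![1, 1, 0] :=
    hv.meet h6 h7 h3 h4 (by decide) (1) _ _ _ (by ring) (by ring) (by ring)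
  obtain ⟨a, h1⟩ := hv.join h3 h6 1 (by decide)
  replace h1 : Proportional (v 1) ![1, 0, a] := h1.congr (by ring) (by ring) (by ring)
  obtain ⟨b, h9⟩ := hv.join h1 h4 9 (by decide)
  replace h9 : Proportional (v 9) ![1, b, a] := h9.congr (by ring) (by ring) (by ring)
  obtain ⟨c, h8⟩ := hv.join h9 h5 8 (by decide)
  replace h8 : Proportional (v 8) ![c + 1, b + c, a] := h8.congr (by ring) (by ring) (by ring)
  have h0 : Proportional (v 0) ![c + 1, b + c, a + c] :=
    hv.meet h8 h6 h9 h7 (by decide) (b - 1) _ _ _ (by ring) (by ring) (by ring)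
  have h2 : Proportional (v 2) ![a * c + b, a * b + a * c, a * b + a * c] :=
    hv.meet h0 h1 h3 h7 (by decide) (-1) _ _ _ (by ring) (by ring) (by ring)
  have k0 : a ≠ 0 :=
    hv.ne_zero_of_dvd h1 h3 h4 (by decide) (1) (by ring)
  have k1 : c ≠ 0 :=
    hv.ne_zero_of_dvd h1 h4 h8 (by decide) (-a) (by ring)
  -- The last incidence is again linear, after cancellation of `a` and `c`.
  have hd := hv.det_expr h2 h8 h4 (by decide)
  have he : a - b - c - 1 = 0 :=
    (mul_eq_zero.1 (show ((a) * (c)) * (a - b - c - 1) = 0 by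
      linear_combination -hd)).resolve_left (mul_ne_zero k0 k1)
  obtain rfl : a = b + c + 1 := by linear_combination he
  refine ⟨g, b, c, fun i => ?_⟩
  rw [← hg]
  fin_cases i
  exacts [h0.congr (by ring) (by ring) (by ring),
    h1.congr (by ring) (by ring) (by ring),
    h2.congr (by ring) (by ring) (by ring),
    h3.congr (by ring) (by ring) (by ring),
    h4.congr (by ring) (by ring) (by ring),
    h5.congr (by ring) (by ring) (by ring),
    h6.congr (by ring) (by ring) (by ring),
    h7.congr (by ring) (by ring) (by ring),
    h8.congr (by ring) (by ring) (by ring),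
    h9.congr (by ring) (by ring) (by ring)]

theorem det3_chartThree_eq_zero {R : Type*} [CommRing R] {a b : R}
    {i j k : Fin 10} (hij : i < j) (hjk : j < k) (hs : Shares (tenThreeTable 2) i j k) :
    det3 (chartThree a b i) (chartThree a b j) (chartThree a b k) = 0 := by
  have key : (i, j, k) ∈ ([(0, 1, 2), (0, 6, 8), (0, 7, 9), (1, 3, 6), (1, 4, 9),
      (2, 3, 7), (2, 4, 8), (3, 4, 5), (5, 6, 7), (5, 8, 9)] :
      List (Fin 10 × Fin 10 × Fin 10)) := by
    revert i j k
    decide +kernel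
  simp only [List.mem_cons, Prod.mk.injEq, List.not_mem_nil, or_false] at key
  rcases key with ⟨rfl, rfl, rfl⟩ | ⟨rfl, rfl, rfl⟩ | ⟨rfl, rfl, rfl⟩ | ⟨rfl, rfl, rfl⟩ | ⟨rfl,
      rfl, rfl⟩ |
    ⟨rfl, rfl, rfl⟩ | ⟨rfl, rfl, rfl⟩ | ⟨rfl, rfl, rfl⟩ | ⟨rfl, rfl, rfl⟩ | ⟨rfl, rfl, rfl⟩ <;>
    simp [det3, chartThree] <;> ring

open MvPolynomial in
theorem hasChartThree : HasChart (tenThreeTable 2) := by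
  have he : ∀ (u : Fin 3 → ℂ) i, evalVec u (chartThree (X 0) (X 1) i) =
      chartThree (u 0) (u 1) i := by
    intro u i
    ext j
    fin_cases i <;> fin_cases j <;> simp [evalVec, chartThree]
  refine ⟨chartThree (X 0) (X 1), 0, by simpa using Ideal.isPrime_bot,
    fun u _ i j k hij hjk hs => ?_, fun w hw => ?_⟩
  · rw [he, he, he]
    exact det3_chartThree_eq_zero hij hjk hs
  · obtain ⟨g, a, b, hg⟩ := exists_chartThree hw
    exact ⟨![a, b, 0], map_zero _, g, fun i => by rw [he]; exact hg i⟩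

/-- Homogeneous coordinates for the realizations of `tenThreeTable 3`. -/
def chartFour {R : Type*} [CommRing R] (a b c : R) : Fin 10 → Fin 3 → R :=
  ![![1, b, a + c],
    ![1, 0, a],
    ![c, -a * b + b, c],
    ![1, b, a],
    ![a - b + c, a * b - b ^ 2 + c, a ^ 2 - a * b + a * c - b * c + c],
    ![0, 1, 1],
    ![0, 0, 1],
    ![0, 1, 0],
    ![1, 1, 1],
    ![1, 0, 0]]

/-- The equation satisfied by the parameters of `chartFour`. -/
def relFour {R : Type*} [CommRing R] (a b c : R) : R :=
  a ^ 3 * b - a ^ 2 * b ^ 2 + a ^ 2 * b * c - a ^ 2 * b - a * b ^ 2 * c + a * b ^ 2 + a * b * c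
      - b * c + c ^ 2

theorem exists_chartFour {w : Fin 10 → Fin 3 → ℂ} (hw : IsRealization (tenThreeTable 3) w) :
    ∃ (g : Matrix.GeneralLinearGroup (Fin 3) ℂ) (a b c : ℂ), relFour a b c = 0 ∧
      ∀ i, Proportional (g.1.mulVec (w i)) (chartFour a b c i) := by
  obtain ⟨g, v, hg, hv, h9, h7, h6, h8⟩ :=
    hw.exists_frame (i := 9) (j := 7) (k := 6) (l := 8) (by decide)
  have h5 : Proportional (v 5) ![0, 1, 1] :=
    hv.meet h6 h7 h8 h9 (by decide) (-1) _ _ _ (by ring) (by ring) (by ring)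
  obtain ⟨a, h1⟩ := hv.join h9 h6 1 (by decide)
  replace h1 : Proportional (v 1) ![1, 0, a] := h1.congr (by ring) (by ring) (by ring)
  obtain ⟨b, h3⟩ := hv.join h1 h7 3 (by decide)
  replace h3 : Proportional (v 3) ![1, b, a] := h3.congr (by ring) (by ring) (by ring)
  obtain ⟨c, h0⟩ := hv.join h3 h6 0 (by decide)
  replace h0 : Proportional (v 0) ![1, b, a + c] := h0.congr (by ring) (by ring) (by ring)
  have h4 : Proportional (v 4) ![a - b + c, a * b - b ^ 2 + c, a ^ 2 - a * b + a * c - b * c + c] :=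
    hv.meet h0 h8 h3 h5 (by decide) (1) _ _ _ (by ring) (by ring) (by ring)
  have h2 : Proportional (v 2) ![c, -a * b + b, c] :=
    hv.meet h0 h1 h8 h7 (by decide) (1) _ _ _ (by ring) (by ring) (by ring)
  -- The last incidence is now quadratic in `c` and remains as the relation between the parameters.
  have hd := hv.det_expr h2 h9 h4 (by decide)
  have he : a ^ 3 * b - a ^ 2 * b ^ 2 + a ^ 2 * b * c - a ^ 2 * b - a * b ^ 2 * c + a * b ^ 2 +
      a * b * c - b * c + c ^ 2 = 0 := by
    linear_combination hd
  refine ⟨g, a, b, c, he, fun i => ?_⟩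
  rw [← hg]
  fin_cases i <;> assumption

theorem det3_chartFour_eq_zero {R : Type*} [CommRing R] {a b c : R} (h : relFour a b c = 0)
    {i j k : Fin 10} (hij : i < j) (hjk : j < k) (hs : Shares (tenThreeTable 3) i j k) :
    det3 (chartFour a b c i) (chartFour a b c j) (chartFour a b c k) = 0 := by
  have key : (i, j, k) ∈ ([(0, 1, 2), (0, 3, 6), (0, 4, 8), (1, 3, 7), (1, 6, 9),
      (2, 4, 9), (2, 7, 8), (3, 4, 5), (5, 6, 7), (5, 8, 9)] :
      List (Fin 10 × Fin 10 × Fin 10)) := by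
    revert i j k
    decide +kernel
  simp only [List.mem_cons, Prod.mk.injEq, List.not_mem_nil, or_false] at key
  rw [relFour] at h
  rcases key with ⟨rfl, rfl, rfl⟩ | ⟨rfl, rfl, rfl⟩ | ⟨rfl, rfl, rfl⟩ | ⟨rfl, rfl, rfl⟩ | ⟨rfl,
      rfl, rfl⟩ |
    ⟨rfl, rfl, rfl⟩ | ⟨rfl, rfl, rfl⟩ | ⟨rfl, rfl, rfl⟩ | ⟨rfl, rfl, rfl⟩ | ⟨rfl, rfl, rfl⟩ <;>
    simp [det3, chartFour] <;> first | ring1 | linear_combination (-1) * h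

open MvPolynomial in
theorem hasChartFour : HasChart (tenThreeTable 3) := by
  have he : ∀ (u : Fin 3 → ℂ) i, evalVec u (chartFour (X 1) (X 2) (X 0) i) =
      chartFour (u 1) (u 2) (u 0) i := by
    intro u i
    ext j
    fin_cases i <;> fin_cases j <;> simp [evalVec, chartFour]
  have hr : ∀ u : Fin 3 → ℂ, eval u (relFour (X 1) (X 2) (X 0)) = relFour (u 1) (u 2) (u 0) := by
    intro u
    simp [relFour]
  -- The parameter `c`, in which the relation is quadratic, takes the variable `X 0`; then `a` and
  -- `b` are `X 0` and `X 1` in the coefficients. Eisenstein's criterion is applied at `b`.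
  refine ⟨chartFour (X 1) (X 2) (X 0), relFour (X 1) (X 2) (X 0), ?_,
    fun u hu i j k hij hjk hs => ?_, fun w hw => ?_⟩
  · refine isPrime_span_of_quadratic (A := 1) (B := X 1 * (X 0 ^ 2 - X 0 * X 1 + X 0 - 1))
      (D := X 1 * (X 0 * (X 0 - X 1) * (X 0 - 1))) (p := X 1) ?_ X_prime.irreducible
      (not_dvd_of_eval ![1, 0] (by simp) (by simp)) (dvd_mul_right _ _) (dvd_mul_right _ _) ?_
      isRelPrime_one_left
    · simp [relFour, finSuccEquiv_X_zero, finSuccEquiv_X_one, finSuccEquiv_X_two]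
      ring
    · rw [pow_two, mul_dvd_mul_iff_left X_prime.irreducible.ne_zero]
      exact not_dvd_of_eval ![2, 0] (by simp) (by norm_num)
  · rw [he, he, he]
    exact det3_chartFour_eq_zero (hr u ▸ hu) hij hjk hs
  · obtain ⟨g, a, b, c, h, hg⟩ := exists_chartFour hw
    exact ⟨![c, a, b], (hr _).trans h, g, fun i => by rw [he]; exact hg i⟩

/-- Homogeneous coordinates for the realizations of `tenThreeTable 4`. -/
def chartFive {R : Type*} [CommRing R] (a b : R) : Fin 10 → Fin 3 → R :=
  ![![a, 0, a + 1],
    ![a + 1, 1, 1],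
    ![1, 1, -a],
    ![1, 0, 0],
    ![1, b, 0],
    ![0, 1, 0],
    ![0, 0, 1],
    ![0, -b + 1, -a],
    ![a + 1, b, a + 1],
    ![1, 1, 1]]

theorem exists_chartFive {w : Fin 10 → Fin 3 → ℂ} (hw : IsRealization (tenThreeTable 4) w) :
    ∃ (g : Matrix.GeneralLinearGroup (Fin 3) ℂ) (a b : ℂ), 
      ∀ i, Proportional (g.1.mulVec (w i)) (chartFive a b i) := by
  obtain ⟨g, v, hg, hv, h3, h5, h6, h9⟩ :=
    hw.exists_frame (i := 3) (j := 5) (k := 6) (l := 9) (by decide)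
  obtain ⟨a, h1⟩ := hv.join h9 h3 1 (by decide)
  replace h1 : Proportional (v 1) ![a + 1, 1, 1] := h1.congr (by ring) (by ring) (by ring)
  obtain ⟨b, h2⟩ := hv.join h9 h6 2 (by decide)
  replace h2 : Proportional (v 2) ![1, 1, b + 1] := h2.congr (by ring) (by ring) (by ring)
  have h0 : Proportional (v 0) ![a, 0, -b] :=
    hv.meet h1 h2 h3 h6 (by decide) (1) _ _ _ (by ring) (by ring) (by ring)
  obtain ⟨c, h4⟩ := hv.join h3 h5 4 (by decide)
  replace h4 : Proportional (v 4) ![1, c, 0] := h4.congr (by ring) (by ring) (by ring)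
  have h7 : Proportional (v 7) ![0, -c + 1, b + 1] :=
    hv.meet h2 h4 h5 h6 (by decide) (-1) _ _ _ (by ring) (by ring) (by ring)
  have h8 : Proportional (v 8) ![a + 1, c, -b] :=
    -- The long factor is what the raw coordinates of the intersection have in common; `meet` itself
    -- shows that it is nonzero.
    hv.meet h0 h4 h1 h7 (by decide) (a * b * c + a * c + b * c - b) _ _ _ (by ring) (by ring)
        (by ring)
  have hd := hv.det_expr h8 h9 h5 (by decide)
  have he : a + b + 1 = 0 := by
    linear_combination -hd
  obtain rfl : b = -a - 1 := by linear_combination he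
  refine ⟨g, a, c, fun i => ?_⟩
  rw [← hg]
  fin_cases i
  exacts [h0.congr (by ring) (by ring) (by ring),
    h1.congr (by ring) (by ring) (by ring),
    h2.congr (by ring) (by ring) (by ring),
    h3.congr (by ring) (by ring) (by ring),
    h4.congr (by ring) (by ring) (by ring),
    h5.congr (by ring) (by ring) (by ring),
    h6.congr (by ring) (by ring) (by ring),
    h7.congr (by ring) (by ring) (by ring),
    h8.congr (by ring) (by ring) (by ring),
    h9.congr (by ring) (by ring) (by ring)]

theorem det3_chartFive_eq_zero {R : Type*} [CommRing R] {a b : R}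
    {i j k : Fin 10} (hij : i < j) (hjk : j < k) (hs : Shares (tenThreeTable 4) i j k) :
    det3 (chartFive a b i) (chartFive a b j) (chartFive a b k) = 0 := by
  have key : (i, j, k) ∈ ([(0, 1, 2), (0, 3, 6), (0, 4, 8), (1, 3, 9), (1, 7, 8),
      (2, 4, 7), (2, 6, 9), (3, 4, 5), (5, 6, 7), (5, 8, 9)] :
      List (Fin 10 × Fin 10 × Fin 10)) := by
    revert i j k
    decide +kernel
  simp only [List.mem_cons, Prod.mk.injEq, List.not_mem_nil, or_false] at key
  rcases key with ⟨rfl, rfl, rfl⟩ | ⟨rfl, rfl, rfl⟩ | ⟨rfl, rfl, rfl⟩ | ⟨rfl, rfl, rfl⟩ | ⟨rfl,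
      rfl, rfl⟩ |
    ⟨rfl, rfl, rfl⟩ | ⟨rfl, rfl, rfl⟩ | ⟨rfl, rfl, rfl⟩ | ⟨rfl, rfl, rfl⟩ | ⟨rfl, rfl, rfl⟩ <;>
    simp [det3, chartFive] <;> ring

open MvPolynomial in
theorem hasChartFive : HasChart (tenThreeTable 4) := by
  have he : ∀ (u : Fin 3 → ℂ) i, evalVec u (chartFive (X 0) (X 1) i) =
      chartFive (u 0) (u 1) i := by
    intro u i
    ext j
    fin_cases i <;> fin_cases j <;> simp [evalVec, chartFive]
  refine ⟨chartFive (X 0) (X 1), 0, by simpa using Ideal.isPrime_bot,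
    fun u _ i j k hij hjk hs => ?_, fun w hw => ?_⟩
  · rw [he, he, he]
    exact det3_chartFive_eq_zero hij hjk hs
  · obtain ⟨g, a, b, hg⟩ := exists_chartFive hw
    exact ⟨![a, b, 0], map_zero _, g, fun i => by rw [he]; exact hg i⟩

/-- Homogeneous coordinates for the realizations of `tenThreeTable 5`. -/
def chartSix {R : Type*} [CommRing R] (a b : R) : Fin 10 → Fin 3 → R :=
  ![![a + 1, a, a + 1],
    ![a, a, a + 1],
    ![1, 0, 0],
    ![0, 1, 0],
    ![0, 0, 1],
    ![0, b, a + b + 1],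
    ![1, 1, 1],
    ![a * b + a, a * b + a - b, a * b],
    ![b + 1, b, a + b + 1],
    ![b + 1, b, b]]

theorem exists_chartSix {w : Fin 10 → Fin 3 → ℂ} (hw : IsRealization (tenThreeTable 5) w) :
    ∃ (g : Matrix.GeneralLinearGroup (Fin 3) ℂ) (a b : ℂ), 
      ∀ i, Proportional (g.1.mulVec (w i)) (chartSix a b i) := by
  obtain ⟨g, v, hg, hv, h2, h3, h4, h6⟩ :=
    hw.exists_frame (i := 2) (j := 3) (k := 4) (l := 6) (by decide)
  obtain ⟨a, h1⟩ := hv.join h4 h6 1 (by decide)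
  replace h1 : Proportional (v 1) ![a, a, a + 1] := h1.congr (by ring) (by ring) (by ring)
  have h0 : Proportional (v 0) ![a + 1, a, a + 1] :=
    hv.meet h1 h2 h3 h6 (by decide) (-1) _ _ _ (by ring) (by ring) (by ring)
  obtain ⟨b, h9⟩ := hv.join h2 h6 9 (by decide)
  replace h9 : Proportional (v 9) ![b + 1, b, b] := h9.congr (by ring) (by ring) (by ring)
  obtain ⟨c, h8⟩ := hv.join h9 h4 8 (by decide)
  replace h8 : Proportional (v 8) ![b + 1, b, b + c] := h8.congr (by ring) (by ring) (by ring)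
  have h5 : Proportional (v 5) ![0, b, b + c] :=
    hv.meet h8 h2 h3 h4 (by decide) (-1) _ _ _ (by ring) (by ring) (by ring)
  have h7 : Proportional (v 7) ![a * b + a, a * b + a - b, a * b + a - c + 1] :=
    hv.meet h0 h8 h1 h5 (by decide) (-a * c + b) _ _ _ (by ring) (by ring) (by ring)
  have k0 : b + 1 ≠ 0 :=
    hv.ne_zero_of_dvd h3 h4 h8 (by decide) (1) (by ring)
  have hd := hv.det_expr h7 h9 h3 (by decide)
  have he : a - c + 1 = 0 :=
    (mul_eq_zero.1 (show ((b + 1)) * (a - c + 1) = 0 by linear_combination hd)).resolve_left k0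
  obtain rfl : c = a + 1 := by linear_combination -he
  refine ⟨g, a, b, fun i => ?_⟩
  rw [← hg]
  fin_cases i
  exacts [h0.congr (by ring) (by ring) (by ring),
    h1.congr (by ring) (by ring) (by ring),
    h2.congr (by ring) (by ring) (by ring),
    h3.congr (by ring) (by ring) (by ring),
    h4.congr (by ring) (by ring) (by ring),
    h5.congr (by ring) (by ring) (by ring),
    h6.congr (by ring) (by ring) (by ring),
    h7.congr (by ring) (by ring) (by ring),
    h8.congr (by ring) (by ring) (by ring),
    h9.congr (by ring) (by ring) (by ring)]

theorem det3_chartSix_eq_zero {R : Type*} [CommRing R] {a b : R}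
    {i j k : Fin 10} (hij : i < j) (hjk : j < k) (hs : Shares (tenThreeTable 5) i j k) :
    det3 (chartSix a b i) (chartSix a b j) (chartSix a b k) = 0 := by
  have key : (i, j, k) ∈ ([(0, 1, 2), (0, 3, 6), (0, 7, 8), (1, 4, 6), (1, 5, 7),
      (2, 5, 8), (2, 6, 9), (3, 4, 5), (3, 7, 9), (4, 8, 9)] :
      List (Fin 10 × Fin 10 × Fin 10)) := by
    revert i j k
    decide +kernel
  simp only [List.mem_cons, Prod.mk.injEq, List.not_mem_nil, or_false] at key
  rcases key with ⟨rfl, rfl, rfl⟩ | ⟨rfl, rfl, rfl⟩ | ⟨rfl, rfl, rfl⟩ | ⟨rfl, rfl, rfl⟩ | ⟨rfl,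
      rfl, rfl⟩ |
    ⟨rfl, rfl, rfl⟩ | ⟨rfl, rfl, rfl⟩ | ⟨rfl, rfl, rfl⟩ | ⟨rfl, rfl, rfl⟩ | ⟨rfl, rfl, rfl⟩ <;>
    simp [det3, chartSix] <;> ring

open MvPolynomial in
theorem hasChartSix : HasChart (tenThreeTable 5) := by
  have he : ∀ (u : Fin 3 → ℂ) i, evalVec u (chartSix (X 0) (X 1) i) =
      chartSix (u 0) (u 1) i := by
    intro u i
    ext j
    fin_cases i <;> fin_cases j <;> simp [evalVec, chartSix]
  refine ⟨chartSix (X 0) (X 1), 0, by simpa using Ideal.isPrime_bot,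
    fun u _ i j k hij hjk hs => ?_, fun w hw => ?_⟩
  · rw [he, he, he]
    exact det3_chartSix_eq_zero hij hjk hs
  · obtain ⟨g, a, b, hg⟩ := exists_chartSix hw
    exact ⟨![a, b, 0], map_zero _, g, fun i => by rw [he]; exact hg i⟩

/-- Homogeneous coordinates for the realizations of `tenThreeTable 6`. -/
def chartSeven {R : Type*} [CommRing R] (a b c : R) : Fin 10 → Fin 3 → R :=
  ![![a * b + 2 * b * c + b - c ^ 2 - 2 * c - 1, a * b + b ^ 2 - b, a * c + a + b * c + b - c - 1],
    ![1, 0, 0],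
    ![c + 1, b, c + 1],
    ![0, 1, a],
    ![1, 0, -a + 1],
    ![0, 1, 0],
    ![1, 1, 1],
    ![0, 0, 1],
    ![1, b, -a + 1],
    ![c + 1, b, -a + 1]]

/-- The equation satisfied by the parameters of `chartSeven`. -/
def relSeven {R : Type*} [CommRing R] (a b c : R) : R :=
  a ^ 2 * b ^ 2 + 2 * a * b ^ 2 * c - a * b * c ^ 2 - a * c ^ 2 - a * c - b * c + c ^ 2 + c

theorem exists_chartSeven {w : Fin 10 → Fin 3 → ℂ} (hw : IsRealization (tenThreeTable 6) w) :
    ∃ (g : Matrix.GeneralLinearGroup (Fin 3) ℂ) (a b c : ℂ), relSeven a b c = 0 ∧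
      ∀ i, Proportional (g.1.mulVec (w i)) (chartSeven a b c i) := by
  obtain ⟨g, v, hg, hv, h1, h5, h7, h6⟩ :=
    hw.exists_frame (i := 1) (j := 5) (k := 7) (l := 6) (by decide)
  obtain ⟨a, h3⟩ := hv.join h5 h7 3 (by decide)
  replace h3 : Proportional (v 3) ![0, 1, a] := h3.congr (by ring) (by ring) (by ring)
  have h4 : Proportional (v 4) ![1, 0, -a + 1] :=
    hv.meet h1 h7 h3 h6 (by decide) (1) _ _ _ (by ring) (by ring) (by ring)
  obtain ⟨b, h8⟩ := hv.join h4 h5 8 (by decide)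
  replace h8 : Proportional (v 8) ![1, b, -a + 1] := h8.congr (by ring) (by ring) (by ring)
  obtain ⟨c, h9⟩ := hv.join h8 h1 9 (by decide)
  replace h9 : Proportional (v 9) ![c + 1, b, -a + 1] := h9.congr (by ring) (by ring) (by ring)
  have h2 : Proportional (v 2) ![c + 1, b, c + 1] :=
    hv.meet h9 h7 h5 h6 (by decide) (1) _ _ _ (by ring) (by ring) (by ring)
  have h0 : Proportional (v 0) ![a * b + 2 * b * c + b - c ^ 2 - 2 * c - 1, a * b + b ^ 2 - b, a
      * c + a + b * c + b - c - 1] :=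
    hv.meet h1 h2 h9 h6 (by decide) (1) _ _ _ (by ring) (by ring) (by ring)
  have hd := hv.det_expr h0 h8 h3 (by decide)
  have he : a ^ 2 * b ^ 2 + 2 * a * b ^ 2 * c - a * b * c ^ 2 - a * c ^ 2 - a * c - b * c + c ^
      2 + c = 0 := by
    linear_combination hd
  refine ⟨g, a, b, c, he, fun i => ?_⟩
  rw [← hg]
  fin_cases i <;> assumption

theorem det3_chartSeven_eq_zero {R : Type*} [CommRing R] {a b c : R} (h : relSeven a b c = 0)
    {i j k : Fin 10} (hij : i < j) (hjk : j < k) (hs : Shares (tenThreeTable 6) i j k) :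
    det3 (chartSeven a b c i) (chartSeven a b c j) (chartSeven a b c k) = 0 := by
  have key : (i, j, k) ∈ ([(0, 1, 2), (0, 3, 8), (0, 6, 9), (1, 4, 7), (1, 8, 9),
      (2, 5, 6), (2, 7, 9), (3, 4, 6), (3, 5, 7), (4, 5, 8)] :
      List (Fin 10 × Fin 10 × Fin 10)) := by
    revert i j k
    decide +kernel
  simp only [List.mem_cons, Prod.mk.injEq, List.not_mem_nil, or_false] at key
  rw [relSeven] at h
  rcases key with ⟨rfl, rfl, rfl⟩ | ⟨rfl, rfl, rfl⟩ | ⟨rfl, rfl, rfl⟩ | ⟨rfl, rfl, rfl⟩ | ⟨rfl,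
      rfl, rfl⟩ |
    ⟨rfl, rfl, rfl⟩ | ⟨rfl, rfl, rfl⟩ | ⟨rfl, rfl, rfl⟩ | ⟨rfl, rfl, rfl⟩ | ⟨rfl, rfl, rfl⟩ <;>
    simp [det3, chartSeven] <;> first | ring1 | linear_combination (-1) * h

open MvPolynomial in
theorem hasChartSeven : HasChart (tenThreeTable 6) := by
  have he : ∀ (u : Fin 3 → ℂ) i, evalVec u (chartSeven (X 0) (X 1) (X 2) i) =
      chartSeven (u 0) (u 1) (u 2) i := by
    intro u i
    ext j
    fin_cases i <;> fin_cases j <;> simp [evalVec, chartSeven]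
  have hr : ∀ u : Fin 3 → ℂ, eval u (relSeven (X 0) (X 1) (X 2)) = relSeven (u 0) (u 1) (u 2) := by
    intro u
    simp [relSeven]
  refine ⟨chartSeven (X 0) (X 1) (X 2), relSeven (X 0) (X 1) (X 2), ?_,
    fun u hu i j k hij hjk hs => ?_, fun w hw => ?_⟩
  -- Here the relation is quadratic in `a`, the variable `X 0`, with Eisenstein prime `c`.
  · refine isPrime_span_of_quadratic (A := X 0 ^ 2) (B := X 1 * (X 0 ^ 2 + X 0 ^ 2 - X 0 * X 1 -
      X 1 - 1))
      (D := X 1 * (X 1 + 1 - X 0)) (p := X 1) ?_ X_prime.irreducible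
      (not_dvd_of_eval ![1, 0] (by simp) (by simp)) (dvd_mul_right _ _) (dvd_mul_right _ _) ?_
      (isRelPrime_of_eval X_prime.irreducible ![0, 1] (by simp) (by simp)).pow_left
    · simp [relSeven, finSuccEquiv_X_zero, finSuccEquiv_X_one, finSuccEquiv_X_two, map_ofNat]
      ring
    · rw [pow_two, mul_dvd_mul_iff_left X_prime.irreducible.ne_zero]
      exact not_dvd_of_eval ![0, 0] (by simp) (by norm_num)
  · rw [he, he, he]
    exact det3_chartSeven_eq_zero (hr u ▸ hu) hij hjk hs
  · obtain ⟨g, a, b, c, h, hg⟩ := exists_chartSeven hw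
    exact ⟨![a, b, c], (hr _).trans h, g, fun i => by rw [he]; exact hg i⟩

/-- Homogeneous coordinates for the realizations of `tenThreeTable 7`. -/
def chartEight {R : Type*} [CommRing R] (a b c : R) : Fin 10 → Fin 3 → R :=
  ![![a + 1, a, a + 1],
    ![a, a, a + 1],
    ![1, 0, 0],
    ![a, a + b, a + c + 1],
    ![a, a + b, a + 1],
    ![c + 1, -b + c + 1, 0],
    ![0, 0, 1],
    ![1, 1, 1],
    ![a * b + a + b, 0, a * b - a * c + b],
    ![0, 1, 0]]

/-- The equation satisfied by the parameters of `chartEight`. -/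
def relEight {R : Type*} [CommRing R] (a b c : R) : R :=
  a ^ 2 * c + a ^ 2 + a * b ^ 2 * c - a * b * c ^ 2 + a * b * c + a * b + a * c + a + b ^ 2 * c
      + b * c + b

theorem exists_chartEight {w : Fin 10 → Fin 3 → ℂ} (hw : IsRealization (tenThreeTable 7) w) :
    ∃ (g : Matrix.GeneralLinearGroup (Fin 3) ℂ) (a b c : ℂ), relEight a b c = 0 ∧
      ∀ i, Proportional (g.1.mulVec (w i)) (chartEight a b c i) := by
  obtain ⟨g, v, hg, hv, h2, h9, h6, h7⟩ :=
    hw.exists_frame (i := 2) (j := 9) (k := 6) (l := 7) (by decide)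
  obtain ⟨a, h1⟩ := hv.join h6 h7 1 (by decide)
  replace h1 : Proportional (v 1) ![a, a, a + 1] := h1.congr (by ring) (by ring) (by ring)
  have h0 : Proportional (v 0) ![a + 1, a, a + 1] :=
    hv.meet h1 h2 h9 h7 (by decide) (-1) _ _ _ (by ring) (by ring) (by ring)
  obtain ⟨b, h4⟩ := hv.join h1 h9 4 (by decide)
  replace h4 : Proportional (v 4) ![a, a + b, a + 1] := h4.congr (by ring) (by ring) (by ring)
  obtain ⟨c, h3⟩ := hv.join h4 h6 3 (by decide)
  replace h3 : Proportional (v 3) ![a, a + b, a + c + 1] := h3.congr (by ring) (by ring) (by ring)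
  have h8 : Proportional (v 8) ![a * b + a + b, 0, a * b - a * c + b] :=
    hv.meet h0 h3 h2 h6 (by decide) (1) _ _ _ (by ring) (by ring) (by ring)
  have h5 : Proportional (v 5) ![c + 1, -b + c + 1, 0] :=
    hv.meet h9 h2 h3 h7 (by decide) (1) _ _ _ (by ring) (by ring) (by ring)
  have hd := hv.det_expr h5 h8 h4 (by decide)
  have he : a ^ 2 * c + a ^ 2 + a * b ^ 2 * c - a * b * c ^ 2 + a * b * c + a * b + a * c + a +
      b ^ 2 * c + b * c + b = 0 := by
    linear_combination -hd
  refine ⟨g, a, b, c, he, fun i => ?_⟩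
  rw [← hg]
  fin_cases i <;> assumption

theorem det3_chartEight_eq_zero {R : Type*} [CommRing R] {a b c : R} (h : relEight a b c = 0)
    {i j k : Fin 10} (hij : i < j) (hjk : j < k) (hs : Shares (tenThreeTable 7) i j k) :
    det3 (chartEight a b c i) (chartEight a b c j) (chartEight a b c k) = 0 := by
  have key : (i, j, k) ∈ ([(0, 1, 2), (0, 3, 8), (0, 7, 9), (1, 4, 9), (1, 6, 7),
      (2, 5, 9), (2, 6, 8), (3, 4, 6), (3, 5, 7), (4, 5, 8)] :
      List (Fin 10 × Fin 10 × Fin 10)) := by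
    revert i j k
    decide +kernel
  simp only [List.mem_cons, Prod.mk.injEq, List.not_mem_nil, or_false] at key
  rw [relEight] at h
  rcases key with ⟨rfl, rfl, rfl⟩ | ⟨rfl, rfl, rfl⟩ | ⟨rfl, rfl, rfl⟩ | ⟨rfl, rfl, rfl⟩ | ⟨rfl,
      rfl, rfl⟩ |
    ⟨rfl, rfl, rfl⟩ | ⟨rfl, rfl, rfl⟩ | ⟨rfl, rfl, rfl⟩ | ⟨rfl, rfl, rfl⟩ | ⟨rfl, rfl, rfl⟩ <;>
    simp [det3, chartEight] <;> first | ring1 | linear_combination (-1) * h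

open MvPolynomial in
theorem hasChartEight : HasChart (tenThreeTable 7) := by
  have he : ∀ (u : Fin 3 → ℂ) i, evalVec u (chartEight (X 1) (X 2) (X 0) i) =
      chartEight (u 1) (u 2) (u 0) i := by
    intro u i
    ext j
    fin_cases i <;> fin_cases j <;> simp [evalVec, chartEight]
  have hr : ∀ u : Fin 3 → ℂ, eval u (relEight (X 1) (X 2) (X 0)) = relEight (u 1) (u 2) (u 0) := by
    intro u
    simp [relEight]
  refine ⟨chartEight (X 1) (X 2) (X 0), relEight (X 1) (X 2) (X 0), ?_,
    fun u hu i j k hij hjk hs => ?_, fun w hw => ?_⟩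
  -- Quadratic in `c`, with Eisenstein prime `a + 1`.
  · refine isPrime_span_of_quadratic (A := -(X 0 * X 1)) (B := (X 0 + 1) * (X 0 + X 1 ^ 2 + X 1))
      (D := (X 0 + 1) * (X 0 + X 1)) (p := X 0 + 1) ?_ irreducible_X_zero_add_one
      (not_dvd_of_eval ![-1, 1] (by simp) (by simp)) (dvd_mul_right _ _) (dvd_mul_right _ _) ?_
      (IsRelPrime.mul_left (isRelPrime_of_eval X_prime.irreducible ![0, 1] (by simp) (by simp))
        (isRelPrime_of_eval X_prime.irreducible ![1, 0] (by simp) (by simp))).neg_left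
    · simp [relEight, finSuccEquiv_X_zero, finSuccEquiv_X_one, finSuccEquiv_X_two]
      ring
    · rw [pow_two, mul_dvd_mul_iff_left irreducible_X_zero_add_one.ne_zero]
      exact not_dvd_of_eval ![-1, 0] (by simp) (by norm_num)
  · rw [he, he, he]
    exact det3_chartEight_eq_zero (hr u ▸ hu) hij hjk hs
  · obtain ⟨g, a, b, c, h, hg⟩ := exists_chartEight hw
    exact ⟨![c, a, b], (hr _).trans h, g, fun i => by rw [he]; exact hg i⟩

/-- Homogeneous coordinates for the realizations of `tenThreeTable 8`. -/
def chartNine {R : Type*} [CommRing R] (a b c : R) : Fin 10 → Fin 3 → R :=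
  ![![a, a + c + 1, a + b],
    ![0, 0, 1],
    ![a ^ 2 + a, a ^ 2 + a * c + 2 * a + c + 1, a ^ 2 + a * b + a * c + a + b * c + b],
    ![a * b - a * c, a * b - a * c + b, a * b - a * c + b],
    ![0, 1, 0],
    ![1, 1, 1],
    ![a * c + a + c + 1, 0, -a * b + a - b * c - b + c + 1],
    ![1, 0, 0],
    ![a, a + 1, a],
    ![a, a + 1, a + b]]

/-- The equation satisfied by the parameters of `chartNine`. -/
def relNine {R : Type*} [CommRing R] (a b c : R) : R :=
  a ^ 2 * b ^ 2 - a ^ 2 * c ^ 2 + a * b ^ 2 * c + a * b ^ 2 - a * b * c ^ 2 + a * b + b * c + b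

theorem exists_chartNine {w : Fin 10 → Fin 3 → ℂ} (hw : IsRealization (tenThreeTable 8) w) :
    ∃ (g : Matrix.GeneralLinearGroup (Fin 3) ℂ) (a b c : ℂ), relNine a b c = 0 ∧
      ∀ i, Proportional (g.1.mulVec (w i)) (chartNine a b c i) := by
  obtain ⟨g, v, hg, hv, h7, h4, h1, h5⟩ :=
    hw.exists_frame (i := 7) (j := 4) (k := 1) (l := 5) (by decide)
  obtain ⟨a, h8⟩ := hv.join h4 h5 8 (by decide)
  replace h8 : Proportional (v 8) ![a, a + 1, a] := h8.congr (by ring) (by ring) (by ring)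
  obtain ⟨b, h9⟩ := hv.join h8 h1 9 (by decide)
  replace h9 : Proportional (v 9) ![a, a + 1, a + b] := h9.congr (by ring) (by ring) (by ring)
  obtain ⟨c, h0⟩ := hv.join h9 h4 0 (by decide)
  replace h0 : Proportional (v 0) ![a, a + c + 1, a + b] := h0.congr (by ring) (by ring) (by ring)
  have h3 : Proportional (v 3) ![a * b - a * c, a * b - a * c + b, a * b - a * c + b] :=
    hv.meet h0 h8 h5 h7 (by decide) (-1) _ _ _ (by ring) (by ring) (by ring)
  have h2 : Proportional (v 2) ![a ^ 2 + a, a ^ 2 + a * c + 2 * a + c + 1, a ^ 2 + a * b + a * c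
      + a + b * c + b] :=
    hv.meet h0 h1 h9 h7 (by decide) (1) _ _ _ (by ring) (by ring) (by ring)
  have h6 : Proportional (v 6) ![a * c + a + c + 1, 0, -a * b + a - b * c - b + c + 1] :=
    hv.meet h1 h7 h2 h5 (by decide) (-1) _ _ _ (by ring) (by ring) (by ring)
  have hd := hv.det_expr h6 h3 h4 (by decide)
  have he : a ^ 2 * b ^ 2 - a ^ 2 * c ^ 2 + a * b ^ 2 * c + a * b ^ 2 - a * b * c ^ 2 + a * b +
      b * c + b = 0 := by
    linear_combination -hd
  refine ⟨g, a, b, c, he, fun i => ?_⟩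
  rw [← hg]
  fin_cases i <;> assumption

theorem det3_chartNine_eq_zero {R : Type*} [CommRing R] {a b c : R} (h : relNine a b c = 0)
    {i j k : Fin 10} (hij : i < j) (hjk : j < k) (hs : Shares (tenThreeTable 8) i j k) :
    det3 (chartNine a b c i) (chartNine a b c j) (chartNine a b c k) = 0 := by
  have key : (i, j, k) ∈ ([(0, 1, 2), (0, 3, 8), (0, 4, 9), (1, 6, 7), (1, 8, 9),
      (2, 5, 6), (2, 7, 9), (3, 4, 6), (3, 5, 7), (4, 5, 8)] :
      List (Fin 10 × Fin 10 × Fin 10)) := by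
    revert i j k
    decide +kernel
  simp only [List.mem_cons, Prod.mk.injEq, List.not_mem_nil, or_false] at key
  rw [relNine] at h
  rcases key with ⟨rfl, rfl, rfl⟩ | ⟨rfl, rfl, rfl⟩ | ⟨rfl, rfl, rfl⟩ | ⟨rfl, rfl, rfl⟩ | ⟨rfl,
      rfl, rfl⟩ |
    ⟨rfl, rfl, rfl⟩ | ⟨rfl, rfl, rfl⟩ | ⟨rfl, rfl, rfl⟩ | ⟨rfl, rfl, rfl⟩ | ⟨rfl, rfl, rfl⟩ <;>
    simp [det3, chartNine] <;> first | ring1 | linear_combination (-1) * h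

open MvPolynomial in
theorem hasChartNine : HasChart (tenThreeTable 8) := by
  have he : ∀ (u : Fin 3 → ℂ) i, evalVec u (chartNine (X 1) (X 2) (X 0) i) =
      chartNine (u 1) (u 2) (u 0) i := by
    intro u i
    ext j
    fin_cases i <;> fin_cases j <;> simp [evalVec, chartNine]
  have hr : ∀ u : Fin 3 → ℂ, eval u (relNine (X 1) (X 2) (X 0)) = relNine (u 1) (u 2) (u 0) := by
    intro u
    simp [relNine]
  refine ⟨chartNine (X 1) (X 2) (X 0), relNine (X 1) (X 2) (X 0), ?_,
    fun u hu i j k hij hjk hs => ?_, fun w hw => ?_⟩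
  -- Quadratic in `c`, with Eisenstein prime `b`.
  · refine isPrime_span_of_quadratic (A := -(X 0 * (X 0 + X 1))) (B := X 1 * (X 0 * X 1 + 1))
      (D := X 1 * ((X 0 + 1) * (X 0 * X 1 + 1))) (p := X 1) ?_ X_prime.irreducible
      (not_dvd_of_eval ![1, 0] (by simp) (by simp)) (dvd_mul_right _ _) (dvd_mul_right _ _) ?_
      (IsRelPrime.mul_left (isRelPrime_of_eval X_prime.irreducible ![0, 1] (by simp) (by simp))
        (isRelPrime_of_eval irreducible_X_zero_add_X_one ![2, -2] (by simp) (by norm_num))).neg_left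
    · simp [relNine, finSuccEquiv_X_zero, finSuccEquiv_X_one, finSuccEquiv_X_two]
      ring
    · rw [pow_two, mul_dvd_mul_iff_left X_prime.irreducible.ne_zero]
      exact not_dvd_of_eval ![0, 0] (by simp) (by norm_num)
  · rw [he, he, he]
    exact det3_chartNine_eq_zero (hr u ▸ hu) hij hjk hs
  · obtain ⟨g, a, b, c, h, hg⟩ := exists_chartNine hw
    exact ⟨![c, a, b], (hr _).trans h, g, fun i => by rw [he]; exact hg i⟩

/-- The combinatorial configuration of ten lines and ten triple points that is not realizable. -/
def antiTable : ConfigurationTable 10 :=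
  ![{1, 2, 3}, {1, 4, 5}, {1, 6, 7}, {2, 4, 8}, {2, 5, 9}, {3, 6, 8}, {3, 7, 9}, {8, 9, 10}, {4,
    6, 10}, {5, 7, 10}]

theorem not_isRealization_antiTable {w : Fin 10 → Fin 3 → ℂ} : ¬ IsRealization antiTable w := by
  intro hw
  obtain ⟨g, v, hg, hv, h5, h6, h1, h7⟩ :=
    hw.exists_frame (i := 5) (j := 6) (k := 1) (l := 7) (by decide)
  obtain ⟨a, h3⟩ := hv.join h5 h7 3 (by decide)
  replace h3 : Proportional (v 3) ![a + 1, a, a] := h3.congr (by ring) (by ring) (by ring)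
  obtain ⟨b, h4⟩ := hv.join h6 h7 4 (by decide)
  replace h4 : Proportional (v 4) ![b, b + 1, b] := h4.congr (by ring) (by ring) (by ring)
  have h0 : Proportional (v 0) ![-b, a, 0] :=
    hv.meet h3 h4 h5 h6 (by decide) (1) _ _ _ (by ring) (by ring) (by ring)
  obtain ⟨c, h2⟩ := hv.join h0 h1 2 (by decide)
  replace h2 : Proportional (v 2) ![-b, a, c] := h2.congr (by ring) (by ring) (by ring)
  have h9 : Proportional (v 9) ![b, b + 1, -c] :=
    hv.meet h1 h4 h2 h6 (by decide) (-b) _ _ _ (by ring) (by ring) (by ring)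
  have h8 : Proportional (v 8) ![a + 1, a, c] :=
    hv.meet h1 h3 h2 h5 (by decide) (-a) _ _ _ (by ring) (by ring) (by ring)
  have k0 : a + b + 1 ≠ 0 :=
    hv.ne_zero_of_dvd h1 h3 h4 (by decide) (1) (by ring)
  have hd := hv.det_expr h8 h9 h7 (by decide)
  have he : (a + b + 1) = 0 := by linear_combination hd
  exact absurd he k0

/-! ### Arrangements with a given table -/

section Table

variable {n : ℕ} {A B : Fin n → DualPlane} {C : ConfigurationTable n}

theorem eq_of_mem_line {P Q : DualPlane} (hPQ : P ≠ Q) {x y : Plane} (hxP : x ∈ line P)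
    (hxQ : x ∈ line Q) (hyP : y ∈ line P) (hyQ : y ∈ line Q) : x = y :=
  (Configuration.ofField.eq_or_eq_of_orthogonal hxP hxQ hyP hyQ).resolve_left hPQ

theorem exists_mem_line_inter (P Q : DualPlane) : ∃ x, x ∈ line P ∧ x ∈ line Q := by
  obtain ⟨x, ⟨h, -⟩, h'⟩ := (concurrent_iff P P Q).2 (coeffDet_self_left P Q)
  exact ⟨x, h, h'⟩

theorem hasTable_iff : HasTable A C ↔ Function.Injective A ∧ ∀ i j k, i ≠ j → i ≠ k → j ≠ k →
    (coeffDet (A i) (A j) (A k) = 0 ↔ Shares C i j k) := by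
  simp only [HasTable, concurrent_iff, shares_iff]

theorem HasTable.isRealization (h : HasTable A C) : IsRealization C fun i => (A i).rep := by
  rw [hasTable_iff] at h
  refine ⟨fun i j k hij hik hjk => ?_, fun i j hij => ?_⟩
  · rw [← coeffDet_eq]
    exact h.2 i j k hij hik hjk
  · intro h0
    rw [← Projectivization.mk_eq_mk_iff_crossProduct_eq_zero (A i).rep_nonzero (A j).rep_nonzero,
      Projectivization.mk_rep, Projectivization.mk_rep] at h0
    exact hij (h.1 h0)

theorem HasTable.of_mem_totalSet {P : Fin n → DualPlane} {σ : Equiv.Perm (Fin n)}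
    (h : HasTable (A ∘ σ) C) (hP : P ∈ totalSet A) : HasTable (P ∘ σ) C := by
  rw [mem_totalSet_iff] at hP
  rw [hasTable_iff] at h ⊢
  refine ⟨hP.1.comp σ.injective, fun i j k hij hik hjk => ?_⟩
  rw [← h.2 i j k hij hik hjk]
  exact (hP.2 _ _ _).symm

theorem Shares.swap {i j k : Fin n} (h : Shares C i j k) : Shares C j i k := by
  rw [shares_iff] at h ⊢
  obtain ⟨e, h1, h2, h3⟩ := h
  exact ⟨e, h2, h1, h3⟩

theorem Shares.rotate {i j k : Fin n} (h : Shares C i j k) : Shares C j k i := by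
  rw [shares_iff] at h ⊢
  obtain ⟨e, h1, h2, h3⟩ := h
  exact ⟨e, h2, h3, h1⟩

theorem det3_swap {R : Type*} [CommRing R] (x y z : Fin 3 → R) : det3 y x z = -det3 x y z := by
  simp only [det3]
  ring

theorem det3_rotate {R : Type*} [CommRing R] (x y z : Fin 3 → R) : det3 y z x = det3 x y z := by
  simp only [det3]
  ring

/-- By antisymmetry of the determinant, only increasing triples have to be checked for a chart. -/
theorem det3_eq_zero_of_sorted {R : Type*} [CommRing R] {x : Fin n → Fin 3 → R}
    (h : ∀ i j k, i < j → j < k → Shares C i j k → det3 (x i) (x j) (x k) = 0) (i j k : Fin n)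
    (hs : i ≠ j → i ≠ k → j ≠ k → Shares C i j k) : det3 (x i) (x j) (x k) = 0 := by
  by_cases hij : i = j
  · rw [hij, det3]; ring
  by_cases hik : i = k
  · rw [hik, det3]; ring
  by_cases hjk : j = k
  · rw [hjk, det3]; ring
  replace hs := hs hij hik hjk
  rcases lt_or_gt_of_ne hij with h1 | h1 <;> rcases lt_or_gt_of_ne hik with h2 | h2 <;>
    rcases lt_or_gt_of_ne hjk with h3 | h3
  · exact h _ _ _ h1 h3 hs
  · rw [← neg_eq_zero, ← det3_swap, ← det3_rotate, h _ _ _ h2 h3 hs.swap.rotate]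
  · omega
  · rw [← det3_rotate, ← det3_rotate, h _ _ _ h2 h1 hs.rotate.rotate]
  · rw [← neg_eq_zero, ← det3_swap, h _ _ _ h1 h2 hs.swap]
  · omega
  · rw [← det3_rotate, h _ _ _ h3 h2 hs.rotate]
  · rw [← neg_eq_zero, ← det3_swap, ← det3_rotate, ← det3_rotate,
      h _ _ _ h3 h1 hs.swap.rotate.rotate]

theorem HasTable.irreducibleSpace [Nontrivial (Fin n)] {σ : Equiv.Perm (Fin n)}
    (h : HasTable (A ∘ σ) C) (hC : HasChart C)
    (hpair : ∀ i j, i ≠ j → ∃ k, (i ≠ k ∧ j ≠ k) ∧ ¬ Shares C i j k) :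
    IrreducibleSpace (ModuliSpace A) := by
  obtain ⟨φ, f, hf, hz, hw⟩ := hC
  have hA : Function.Injective A := by
    have := h.1.comp σ.symm.injective
    rwa [Function.comp_assoc, Equiv.self_comp_symm, Function.comp_id] at this
  have hdet : ∀ i j k, σ.symm i ≠ σ.symm j → σ.symm i ≠ σ.symm k → σ.symm j ≠ σ.symm k →
      (coeffDet (A i) (A j) (A k) = 0 ↔ Shares C (σ.symm i) (σ.symm j) (σ.symm k)) := by
    intro i j k hij hik hjk
    simpa using (hasTable_iff.1 h).2 _ _ _ hij hik hjk
  refine irreducibleSpace_moduliSpace_of_chart hA (fun i => φ (σ.symm i)) f hf ?_ ?_ ?_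
  · intro u hu i j k h0
    exact det3_eq_zero_of_sorted (x := fun i => evalVec u (φ i)) (hz u hu) _ _ _
      fun hij hik hjk => (hdet i j k hij hik hjk).1 h0
  · intro i j hij
    have hij' : σ.symm i ≠ σ.symm j := σ.symm.injective.ne hij
    obtain ⟨k, ⟨hik, hjk⟩, hk⟩ := hpair _ _ hij'
    refine ⟨σ k, ?_⟩
    rw [Ne, hdet i j (σ k) hij' (by simpa using hik) (by simpa using hjk)]
    simpa using hk
  · intro P hP
    obtain ⟨u, hu, g, hg⟩ := hw _ (h.of_mem_totalSet hP).isRealization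
    exact ⟨u, hu, g, fun i => by simpa using hg (σ.symm i)⟩

end Table

/-! ### Existence -/

section Existence

/-- A point on three lines determines a label `e` common to their columns. By `hC3` every further
line through the point also has `e`, and by `hC4` there are only three such lines. So the triple
points correspond to the ten labels and no point has higher multiplicity. -/
theorem HasTable.isTenLinesTenTriples {A : Fin 10 → DualPlane} {C : ConfigurationTable 10}
    (h : HasTable A C) (hC1 : ∀ i, (C i).card = 3) (hC2 : ∀ i, C i ⊆ Finset.Icc 1 10)
    (hC3 : ∀ i j, i ≠ j → (C i ∩ C j).card ≤ 1)
    (hC4 : ∀ e ∈ Finset.Icc 1 10, (Finset.univ.filter fun i => e ∈ C i).card = 3) :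
    IsTenLinesTenTriples A := by
  classical
  have huniq : ∀ {i j e e'}, i ≠ j → e ∈ C i → e ∈ C j → e' ∈ C i → e' ∈ C j → e = e' := by
    intro i j e e' hij h1 h2 h3 h4
    exact Finset.card_le_one.1 (hC3 i j hij) e (Finset.mem_inter.2 ⟨h1, h2⟩) e'
      (Finset.mem_inter.2 ⟨h3, h4⟩)
  -- the lines through a point of multiplicity at least three
  have hmult : ∀ x, 3 ≤ multiplicity A x →
      ∃ e ∈ Finset.Icc 1 10, ∀ i, x ∈ line (A i) ↔ e ∈ C i := by
    intro x hx
    rw [multiplicity, Set.ncard_eq_toFinset_card'] at hx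
    obtain ⟨i, j, k, hi, hj, hk, hij, hik, hjk⟩ := Finset.two_lt_card_iff.1 hx
    simp only [Set.mem_toFinset, Set.mem_ofPred_eq] at hi hj hk
    obtain ⟨e, hei, hej, hek⟩ := (h.2 i j k hij hik hjk).1 ⟨x, ⟨hi, hj⟩, hk⟩
    have hsub : ∀ l, x ∈ line (A l) → e ∈ C l := by
      intro l hl
      by_cases hli : i = l
      · rwa [← hli]
      by_cases hlj : j = l
      · rwa [← hlj]
      obtain ⟨e', h1, h2, h3⟩ := (h.2 i j l hij hli hlj).1 ⟨x, ⟨hi, hj⟩, hl⟩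
      rwa [huniq hij hei hej h1 h2]
    have heq := Finset.eq_of_subset_of_card_le
      (s := {l | x ∈ line (A l)}.toFinset) (t := Finset.univ.filter fun i => e ∈ C i)
      (fun l hl => by
        simp only [Set.mem_toFinset, Set.mem_ofPred_eq] at hl
        simpa using hsub l hl)
      (by rw [hC4 e (hC2 i hei)]; exact hx)
    refine ⟨e, hC2 i hei, fun l => ⟨hsub l, fun hl => ?_⟩⟩
    have : l ∈ {l | x ∈ line (A l)}.toFinset := by
      rw [heq]
      simpa using hl
    simpa using this
  have hcard : ∀ x e, e ∈ Finset.Icc 1 10 → (∀ i, x ∈ line (A i) ↔ e ∈ C i) →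
      multiplicity A x = 3 := by
    intro x e he hx
    rw [multiplicity, Set.ncard_eq_toFinset_card', ← hC4 e he]
    congr 1
    ext i
    simp [hx]
  have hpt : ∀ e ∈ Finset.Icc 1 10, ∃ x, ∀ i, x ∈ line (A i) ↔ e ∈ C i := by
    intro e he
    obtain ⟨i, j, k, hi, hj, hk, hij, hik, hjk⟩ :=
      Finset.two_lt_card_iff.1 (by rw [hC4 e he]; norm_num :
        2 < (Finset.univ.filter fun i => e ∈ C i).card)
    simp only [Finset.mem_filter, Finset.mem_univ, true_and] at hi hj hk
    obtain ⟨x, ⟨hxi, hxj⟩, hxk⟩ := (h.2 i j k hij hik hjk).2 ⟨e, hi, hj, hk⟩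
    have h3 : 3 ≤ multiplicity A x := by
      rw [multiplicity, Set.ncard_eq_toFinset_card']
      exact Finset.two_lt_card_iff.2 ⟨i, j, k, by simpa using hxi, by simpa using hxj,
        by simpa using hxk, hij, hik, hjk⟩
    obtain ⟨e', -, hx⟩ := hmult x h3
    refine ⟨x, ?_⟩
    rwa [huniq hij hi hj ((hx i).1 hxi) ((hx j).1 hxj)]
  choose! X hX using hpt
  have hinj : Set.InjOn X (Finset.Icc 1 10 : Finset ℕ) := by
    intro e he e' he' hee
    obtain ⟨i, j, -, hi, hj, -, hij, -, -⟩ :=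
      Finset.two_lt_card_iff.1 (by rw [hC4 e he]; norm_num :
        2 < (Finset.univ.filter fun i => e ∈ C i).card)
    simp only [Finset.mem_filter, Finset.mem_univ, true_and] at hi hj
    have h1 := (hX e he i).2 hi
    have h2 := (hX e he j).2 hj
    rw [hee] at h1 h2
    exact huniq hij hi hj ((hX e' he' i).1 h1) ((hX e' he' j).1 h2)
  have htriple : triplePoints A = X '' (Finset.Icc 1 10 : Finset ℕ) := by
    ext x
    constructor
    · intro hx
      obtain ⟨e, he, hxe⟩ := hmult x (le_of_eq (Eq.symm hx))
      refine ⟨e, he, ?_⟩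
      obtain ⟨i, j, -, hi, hj, -, hij, -, -⟩ :=
        Finset.two_lt_card_iff.1 (by rw [hC4 e he]; norm_num :
          2 < (Finset.univ.filter fun i => e ∈ C i).card)
      simp only [Finset.mem_filter, Finset.mem_univ, true_and] at hi hj
      exact eq_of_mem_line (h.1.ne hij) ((hX e he i).2 hi) ((hX e he j).2 hj) ((hxe i).2 hi)
        ((hxe j).2 hj)
    · rintro ⟨e, he, rfl⟩
      exact hcard _ e he (hX e he)
  have hfin : (triplePoints A).Finite := by
    rw [htriple]
    exact (Finset.finite_toSet _).image _
  refine ⟨h.1, fun x => ?_, fun i => ?_, ?_⟩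
  · by_contra! hx
    obtain ⟨e, he, hxe⟩ := hmult x hx.le
    rw [hcard x e he hxe] at hx
    exact lt_irrefl _ hx
  · have hsub : X '' (C i) ⊆ triplePoints A ∩ line (A i) := by
      rintro _ ⟨e, he, rfl⟩
      refine ⟨?_, (hX e (hC2 i he) i).2 he⟩
      rw [htriple]
      exact ⟨e, hC2 i he, rfl⟩
    calc 3 = (X '' (C i)).ncard := by
          rw [(hinj.mono (by exact_mod_cast hC2 i)).ncard_image,
            Set.ncard_coe_finset, hC1]
      _ ≤ _ := Set.ncard_le_ncard hsub (hfin.inter_of_left _)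
  · rw [htriple, hinj.ncard_image, Set.ncard_coe_finset]
    rfl

theorem det3_intCast (x y z : Fin 3 → ℤ) :
    det3 (fun i => (x i : ℂ)) (fun i => (y i : ℂ)) (fun i => (z i : ℂ)) = (det3 x y z : ℤ) := by
  simp [det3]

/-- Over the integers the conditions on determinants are decidable. -/
theorem exists_hasTable_of_int {n : ℕ} [Nontrivial (Fin n)] {C : ConfigurationTable n}
    (v : Fin n → Fin 3 → ℤ)
    (h : ∀ i j k, i ≠ j → i ≠ k → j ≠ k → (det3 (v i) (v j) (v k) = 0 ↔ Shares C i j k))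
    (hpair : ∀ i j, i ≠ j → ∃ k, (i ≠ k ∧ j ≠ k) ∧ ¬ Shares C i j k) :
    ∃ A : Fin n → DualPlane, HasTable A C := by
  have hdet : ∀ i j k, det3 (fun l => (v i l : ℂ)) (fun l => (v j l : ℂ)) (fun l => (v k l : ℂ)) = 0
      ↔ det3 (v i) (v j) (v k) = 0 := by
    intro i j k
    rw [det3_intCast]
    exact Int.cast_eq_zero
  have hne : ∀ i, (fun l => (v i l : ℂ)) ≠ 0 := by
    intro i h0
    obtain ⟨j, hj⟩ := exists_ne i
    obtain ⟨k, ⟨hik, hjk⟩, hk⟩ := hpair i j hj.symm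
    rw [← h i j k hj.symm hik hjk, ← hdet, h0] at hk
    simp [det3] at hk
  refine ⟨fun i => .mk ℂ _ (hne i), hasTable_iff.2 ⟨fun i j hij => ?_, fun i j k hij hik hjk => ?_⟩⟩
  · by_contra hne'
    obtain ⟨k, ⟨hik, hjk⟩, hk⟩ := hpair i j hne'
    rw [← h i j k hne' hik hjk, ← hdet, ← coeffDet_mk_eq_zero_iff (hne i) (hne j) (hne k)] at hk
    simp only at hij
    rw [hij, coeffDet_self_left] at hk
    exact hk rfl
  · rw [coeffDet_mk_eq_zero_iff, hdet, h i j k hij hik hjk]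

/-- Integral coordinates of a realization of each of the nine tables. -/
def integralRealization : Fin 9 → Fin 10 → Fin 3 → ℤ :=
  ![![![1, 0, 0], ![0, 1, 0], ![1, -1, 0], ![0, 1, -1], ![1, 2, 1],
      ![1, 1, 2], ![0, 0, 1], ![1, 1, 1], ![1, 0, -1], ![2, 1, 1]],
    ![![1, 0, 1], ![-2, -1, -3], ![2, -1, 1], ![2, -1, -3], ![2, 3, 1],
      ![1, 1, 0], ![1, 0, 0], ![0, 1, 0], ![0, 0, 1], ![1, 1, 1]],
    ![![-2, -1, -3], ![2, 0, 1], ![2, -1, -1], ![1, 0, 0], ![0, 1, 0],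
      ![1, 1, 0], ![0, 0, 1], ![1, 1, 1], ![-2, -1, 1], ![2, 3, 1]],
    ![![4, -2, 7], ![2, 0, 7], ![-7, 5, -7], ![2, -1, 7], ![3, -5, 7],
      ![0, 1, 1], ![0, 0, 1], ![0, 1, 0], ![1, 1, 1], ![1, 0, 0]],
    ![![1, 0, 2], ![2, 1, 1], ![1, 1, -1], ![1, 0, 0], ![1, -1, 0],
      ![0, 1, 0], ![0, 0, 1], ![0, 2, -1], ![2, -1, 2], ![1, 1, 1]],
    ![![2, 1, 2], ![1, 1, 2], ![1, 0, 0], ![0, 1, 0], ![0, 0, 1],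
      ![0, -1, 3], ![1, 1, 1], ![1, 2, -1], ![1, -1, 3], ![1, -1, -1]],
    ![![-5, 3, -1], ![1, 0, 0], ![1, -3, 1], ![0, 3, 4], ![3, 0, -1],
      ![0, 1, 0], ![1, 1, 1], ![0, 0, 1], ![3, -3, -1], ![1, -3, -1]],
    ![![-1, -8, -1], ![-8, -8, -1], ![1, 0, 0], ![-4, 3, 1], ![-8, 6, -1],
      ![5, -2, 0], ![0, 0, 1], ![1, 1, 1], ![-7, 0, 1], ![0, 1, 0]],
    ![![2, 3, -4], ![0, 0, 1], ![2, 3, -2], ![-1, -5, -5], ![0, 1, 0],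
      ![1, 1, 1], ![1, 0, 5], ![1, 0, 0], ![1, 3, 1], ![1, 3, -2]]]

theorem tenThreeTable_exists_not_shares (c : Fin 9) :
    ∀ i j, i ≠ j → ∃ k, (i ≠ k ∧ j ≠ k) ∧ ¬ Shares (tenThreeTable c) i j k := by
  revert c
  decide +kernel

theorem exists_hasTable_tenThreeTable (c : Fin 9) :
    ∃ A : Fin 10 → DualPlane, IsTenLinesTenTriples A ∧ HasTable A (tenThreeTable c) := by
  obtain ⟨A, hA⟩ := exists_hasTable_of_int (C := tenThreeTable c) (integralRealization c)
    (by revert c; decide +kernel) (tenThreeTable_exists_not_shares c)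
  refine ⟨A, hA.isTenLinesTenTriples ?_ ?_ ?_ ?_, hA⟩ <;>
    · clear hA A
      decide +revert +kernel

end Existence

/-! ### Zariski pairs -/

section ZariskiPair

/-- Two distinct lines meet in exactly one point, so concurrency with a third line is an inclusion
of flats and can be read off the lattice. -/
theorem SameLattice.mem_totalSet {n : ℕ} {A B : Fin n → DualPlane} (hA : Function.Injective A)
    (hB : Function.Injective B) (h : SameLattice A B) : B ∈ totalSet A := by
  have key : ∀ (D : Fin n → DualPlane), Function.Injective D → ∀ i j k, i ≠ j →
      ((line (D i) ∩ line (D j) ∩ line (D k)).Nonempty ↔ flat D {i, j} ⊆ flat D {k}) := by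
    intro D hD i j k hij
    have e1 : flat D {i, j} = line (D i) ∩ line (D j) := by simp [flat]
    have e2 : flat D {k} = line (D k) := by simp [flat]
    rw [e1, e2]
    constructor
    · rintro ⟨x, ⟨hxi, hxj⟩, hxk⟩ y ⟨hyi, hyj⟩
      rwa [eq_of_mem_line (hD.ne hij) hyi hyj hxi hxj]
    · intro hsub
      obtain ⟨x, hi, hj⟩ := exists_mem_line_inter (D i) (D j)
      exact ⟨x, ⟨hi, hj⟩, hsub ⟨hi, hj⟩⟩
  refine mem_totalSet_iff.2 ⟨hB, fun i j k => ?_⟩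
  by_cases hij : i = j
  · simp [hij, coeffDet_self_left]
  · rw [← concurrent_iff, ← concurrent_iff, key A hA i j k hij, key B hB i j k hij]
    exact h _ _

theorem not_isPotentialZariskiPair_of_irreducibleSpace {n : ℕ} {A : Fin n → DualPlane}
    [IrreducibleSpace (ModuliSpace A)] (B : Fin n → DualPlane) :
    ¬ IsPotentialZariskiPair A B := by
  rintro ⟨hA, hB, σ, hσ, hno⟩
  refine hno ⟨⟨A, mem_totalSet_self hA⟩,
    ⟨B ∘ σ, hσ.mem_totalSet hA (hB.comp σ.injective)⟩, rfl, Or.inl rfl, Set.univ, ?_,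
    Set.mem_univ _, Set.mem_univ _⟩
  rw [irreducibleComponents_eq_singleton]
  rfl

end ZariskiPair

/-! ### Sets of labels and permutations as natural numbers -/

section Code

/-- The value of `k` at `n`; the kernel evaluates `n` before it substitutes it into `k`. -/
def forced {α : Sort*} (n : ℕ) (k : ℕ → α) : α :=
  match n with
  | 0 => k 0
  | m + 1 => k (m + 1)

/-- The continuation `k` applied to `l.filter f`, with all elements evaluated. -/
def filterThen {α : Sort*} (f : ℕ → Bool) (k : List ℕ → α) : List ℕ → α
  | [] => k []
  | a :: l => forced a fun a =>
      bif f a then filterThen f (fun r => k (a :: r)) l else filterThen f k l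

/-- Two lines that meet in at most one point, as bit masks. -/
def compat (c d : ℕ) : Bool := forced (Nat.land c d) fun x => Nat.beq (Nat.land x (x - 1)) 0

/-- The image of the label `i` under the permutation with decimal code `m`, whose `i`-th digit
is the image of `i`. -/
def permDigit (m i : ℕ) : ℕ := Nat.mod (Nat.div m (Nat.pow 10 i)) 10

/-- The image of the bit mask `d` under the permutation with code `m`; the labels below `n`
contribute. -/
noncomputable def permMask (m d n : ℕ) : ℕ :=
  Nat.rec 0 (fun n r => Nat.add r
    (Nat.mul (Nat.mod (Nat.div d (Nat.pow 2 n)) 2) (Nat.pow 2 (permDigit m n)))) n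

/-- The code of the composition of two permutations. -/
def permMul (m m' : ℕ) : ℕ → ℕ
  | 0 => 0
  | n + 1 => permMul m m' n + permDigit m (permDigit m' n) * 10 ^ n

/-- The code of the identity. -/
def permOne : ℕ := 9876543210

/-- The code of the transposition of `a` and `b`. -/
def permSwap (a b : ℕ) : ℕ :=
  permOne - a * 10 ^ a - b * 10 ^ b + b * 10 ^ a + a * 10 ^ b

/-- All products of one factor from each list. -/
def permProducts : List (List ℕ) → List ℕ
  | [] => [permOne]
  | l :: L => l.flatMap fun m => (permProducts L).map fun m' => permMul m m' 10

/-- The transpositions of `a` with the elements of `l`, and the identity. -/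
def permSwaps (a : ℕ) (l : List ℕ) : List ℕ := permOne :: l.map (permSwap a)

/-- The bit mask of the set of elements of `l`. -/
def setMask : List ℕ → ℕ
  | [] => 0
  | d :: l => Nat.lor (setMask l) (2 ^ d)

end Code

/-! ### The search -/

section Search

/-- The blocks of the nine tables, and of the table that is not realizable. -/
def tableMasks : List (List ℕ) :=
  [[7, 74, 146, 268, 532, 321, 641, 56, 224, 800],
    [7, 321, 641, 74, 530, 268, 148, 224, 800, 56],
    [7, 321, 641, 74, 530, 140, 276, 224, 800, 56],
    [7, 73, 273, 138, 578, 388, 532, 56, 224, 800],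
    [7, 73, 273, 522, 386, 580, 148, 56, 224, 800],
    [7, 73, 385, 82, 162, 580, 292, 56, 648, 784],
    [7, 577, 265, 770, 146, 644, 100, 88, 168, 304],
    [7, 265, 641, 530, 194, 548, 324, 88, 168, 304],
    [7, 529, 265, 770, 194, 644, 100, 88, 168, 304],
    [7, 25, 97, 266, 530, 292, 580, 168, 208, 896]]

/-- Permutations that carry the configurations found by the search to the tables. -/
def tablePerms : List (List ℕ) :=
  [[5439786210],
    [798261543, 5437986210, 5784936201, 5789463021, 7098254613, 7589402631, 7850294631, 7905482613],
    [218976435, 892716453, 2104398765, 2491308756, 4291380576, 4293157806, 4352197860, 4539721860,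
      4925731806, 5437986210, 5784936201, 5879463021, 8579402631, 8750294631, 9248075136,
      9428057136, 9804527163],
    [124398675, 491328657, 2014389765, 2019867435, 2109876435, 4092831567, 4825703916, 4902813567,
      4905682317, 5798436210, 5974863210, 8249157036, 8294517063, 8452073961, 9048265137,
      9408256137, 9752184630],
    [2017689435, 2108976435, 2780619453, 2871906453, 5794863210, 5976348210, 7280645193,
      7289154603, 7598421630, 7824506193, 7825491603, 7952184630, 8271945063, 8724519063],
    [697128345, 962871345, 1280654793, 1825406793, 2180679543, 2184560973, 2816045973, 2817906543,
      4592163870, 4953678120, 4956321870, 5498712360, 5874192306, 5948721360, 6091734285,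
      6092843175, 6903417285, 6904328175, 8125479063, 8217954063, 9068234715, 9453687210,
      9603482715],
    [1780934256, 1782590436, 1870943256, 4537281609, 4573821690, 7185243906, 8174309526,
      8714390526, 9120864753, 9210875643],
    [3475986012, 3476810592, 3746801592, 4567938120, 4735968102, 5463897210, 5643879210,
      7341095682, 7439510682, 8356720491],
    [6573821490, 7652149380],
    [7659483201, 7986543210, 9872165430]]

/-- Do all members of `bs` go to members of `t` under one of the permutations in `l`? -/
noncomputable def anyPerm (bs : List ℕ) (t : ℕ) (l : List ℕ) : Bool :=
  l.any fun m => bs.all fun b => Nat.testBit t (permMask m b 10)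

/-- Is `bs` carried into one of the tables by one of the permutations? -/
noncomputable def isTable (bs : List ℕ) : Bool :=
  (tableMasks.zip tablePerms).any fun x => forced (setMask x.1) fun t => anyPerm bs t x.2

/-- Exhaustive search for the configurations that contain the blocks `bs` and whose other blocks
are among `cands`, for the points from `p` on. The first list in `Gs` is a list of permutations
among which symmetries are looked for. -/
noncomputable def search : ℕ → ℕ → List ℕ → List ℕ → List (List ℕ) → Bool
  -- Exhausted fuel counts as failure, so soundness does not depend on the initial amount.
  | 0, _, _, _, _ => false
  | fuel + 1, p, bs, cands, Gs =>
    bif Nat.beq p 10 then cands.isEmpty && isTable bs else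
    forced (bs.countP fun b => Nat.testBit b p) fun k =>
    -- The point `p` has its three blocks: all other candidates through it are dropped.
    bif Nat.beq k 3 then
      filterThen (fun d => !Nat.testBit d p)
        (fun cands => forced (p + 1) fun p => search fuel p bs cands Gs) cands
    else bif Nat.blt 3 k then true else
    match cands.find? fun d => Nat.testBit d p with
    -- Too few blocks can pass through `p`: there is no configuration in this branch, as in the case
    -- `3 < k`.
    | none => true
    | some c =>
      forced (setMask bs) fun B =>
      forced (setMask cands) fun D =>
      -- Only permutations that preserve both the chosen blocks and the candidates are kept. This
      -- test makes them symmetries of the remaining problem, whatever list was supplied.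
      filterThen (fun m => !Nat.beq m permOne &&
          (bs.all fun b => Nat.testBit B (permMask m b 10)) &&
          cands.all fun d => Nat.testBit D (permMask m d 10))
        (fun G =>
          filterThen (fun d => compat c d && !Nat.beq d c)
            (fun cands => search fuel p (c :: bs) cands
              -- After a block is added the next list is used; when there is none, the surviving
              -- symmetries are kept.
              (match Gs.tail with
              | [] => [G]
              | H :: Gs => H :: Gs)) cands &&
          -- If `c` is rejected, so are all its images under `G`: a configuration containing one of
          -- them can be relabelled into one that contains `c`.
          forced (setMask (G.map fun m => permMask m c 10)) fun O =>
          filterThen (fun d => !Nat.testBit O d && !Nat.beq d c)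
            (fun cands => search fuel p bs cands (G :: Gs.tail)) cands)
        (Gs.headD [])

/-- All triples of labels. -/
def allMasks : List ℕ :=
  (List.range 10).flatMap fun i => ((List.range 10).filter (i < ·)).flatMap fun j =>
    ((List.range 10).filter (j < ·)).map fun k => 2 ^ i + 2 ^ j + 2 ^ k

/-- Symmetries that are of use for the first, the second, the third and the later blocks. -/
noncomputable def searchPerms : List (List ℕ) :=
  [permProducts [permSwaps 1 [3, 4, 5, 6, 7, 8, 9], permSwaps 2 [3, 4, 5, 6, 7, 8, 9]],
    permProducts [permSwaps 3 [5, 6, 7, 8, 9], permSwaps 4 [5, 6, 7, 8, 9]],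
    permProducts [permSwaps 5 [7, 8, 9], permSwaps 6 [7, 8, 9]],
    permProducts [permSwaps 1 [2], permSwaps 3 [4], permSwaps 5 [6],
      [permOne, 9876521430, 9872143650], [permOne, 9874365210], permSwaps 7 [8, 9],
      permSwaps 8 [9]]]

/-- The outer filter removes nothing; it has the candidates evaluated before the search starts. -/
theorem search_eq_true : filterThen (fun _ => true)
    (fun cands => search 150 0 [] cands searchPerms) allMasks = true := by
  decide +kernel

end Search

/-! ### Soundness of the search -/

section Soundness

/-- The bit mask of a set of labels. -/
def enc (s : Finset (Fin 10)) : ℕ := ∑ i ∈ s, 2 ^ (i : ℕ)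

theorem testBit_enc_iff {s : Finset (Fin 10)} {n : ℕ} :
    (enc s).testBit n = true ↔ ∃ i ∈ s, (i : ℕ) = n := by
  have h := Finset.equivBitIndices.right_inv (s.map Fin.valEmbedding)
  have h' : n ∈ Finset.equivBitIndices (∑ i ∈ s.map Fin.valEmbedding, 2 ^ i) ↔
    n ∈ s.map Fin.valEmbedding := by
    conv_rhs => rw [← h]
    rfl
  rw [Finset.sum_map] at h'
  simpa [enc] using h'

theorem testBit_enc {s : Finset (Fin 10)} {i : Fin 10} : (enc s).testBit i = true ↔ i ∈ s := by
  rw [testBit_enc_iff]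
  exact ⟨fun ⟨j, hj, h⟩ => by rwa [← Fin.ext h], fun h => ⟨i, h, rfl⟩⟩

theorem enc_injective : Function.Injective enc := by
  intro s t h
  ext i
  rw [← testBit_enc, h, testBit_enc]

theorem natBeq_eq_false_iff {m n : ℕ} : Nat.beq m n = false ↔ m ≠ n := by
  rw [← Bool.not_eq_true, Nat.beq_eq]

theorem forced_eq {α : Sort*} (n : ℕ) (k : ℕ → α) : forced n k = k n := by
  cases n <;> rfl

theorem filterThen_eq {α : Sort*} (f : ℕ → Bool) (k : List ℕ → α) (l : List ℕ) :
    filterThen f k l = k (l.filter f) := by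
  induction l generalizing k with
  | nil => rfl
  | cons a l ih => cases h : f a <;> simp [filterThen, forced_eq, h, ih]

/-- `x &&& (x - 1)` erases the lowest bit of `x`, so it vanishes when `x` has at most one bit. -/
theorem compat_enc {s t : Finset (Fin 10)} (h : (s ∩ t).card ≤ 1) :
    compat (enc s) (enc t) = true := by
  have hand : Nat.land (enc s) (enc t) = enc (s ∩ t) := by
    refine Nat.eq_of_testBit_eq fun n => ?_
    change (enc s &&& enc t).testBit n = _
    rw [Nat.testBit_and, Bool.eq_iff_iff, Bool.and_eq_true, testBit_enc_iff, testBit_enc_iff,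
      testBit_enc_iff]
    constructor
    · rintro ⟨⟨i, hi, hin⟩, j, hj, hjn⟩
      obtain rfl : i = j := Fin.ext (hin.trans hjn.symm)
      exact ⟨i, Finset.mem_inter.2 ⟨hi, hj⟩, hin⟩
    · rintro ⟨i, hi, hin⟩
      exact ⟨⟨i, (Finset.mem_inter.1 hi).1, hin⟩, i, (Finset.mem_inter.1 hi).2, hin⟩
  rw [compat, forced_eq, hand, Nat.beq_eq]
  change enc (s ∩ t) &&& (enc (s ∩ t) - 1) = 0
  rw [Finset.card_le_one_iff_subset_singleton] at h
  obtain ⟨x, hx⟩ := h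
  rcases Finset.subset_singleton_iff.1 hx with h | h
  · simp [h, enc]
  · simp [h, enc]

theorem testBit_setMask {l : List ℕ} {n : ℕ} : (setMask l).testBit n = true ↔ n ∈ l := by
  induction l with
  | nil => simp [setMask]
  | cons d l ih =>
    change (setMask l ||| 2 ^ d).testBit n = true ↔ _
    rw [Nat.testBit_or, Bool.or_eq_true, ih, Nat.testBit_two_pow, decide_eq_true_eq,
      List.mem_cons, or_comm, eq_comm]

/-- The digits of `m` define a permutation. -/
def IsPermCode (m : ℕ) : Prop := Function.Injective fun i : Fin 10 => permDigit m i

instance : DecidablePred IsPermCode :=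
  fun m => inferInstanceAs (Decidable (Function.Injective fun i : Fin 10 => permDigit m i))

theorem IsPermCode.exists_perm {m : ℕ} (h : IsPermCode m) :
    ∃ σ : Equiv.Perm (Fin 10), ∀ s, permMask m (enc s) 10 = enc (s.map σ.toEmbedding) := by
  have hlt : ∀ i, permDigit m i < 10 := fun i => Nat.mod_lt _ (by norm_num)
  refine ⟨Equiv.ofBijective (fun i => ⟨permDigit m i, hlt i⟩) (Finite.injective_iff_bijective.1
    fun i j hij => h (Fin.mk.inj_iff.1 hij)), fun s => ?_⟩
  have hsum : ∀ n, permMask m (enc s) n =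
      ∑ i ∈ Finset.range n, enc s / 2 ^ i % 2 * 2 ^ permDigit m i := by
    intro n
    induction n with
    | zero => rfl
    | succ n ih => rw [Finset.sum_range_succ, ← ih]; rfl
  rw [hsum, ← Fin.sum_univ_eq_sum_range (fun i => enc s / 2 ^ i % 2 * 2 ^ permDigit m i)]
  nth_rw 2 [enc]
  rw [Finset.sum_map, ← Finset.sum_filter_add_sum_filter_not Finset.univ (· ∈ s),
    Finset.filter_mem_eq_inter, Finset.univ_inter]
  rw [Finset.sum_eq_zero (s := Finset.univ.filter _), add_zero]
  · refine Finset.sum_congr rfl fun i hi => ?_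
    have := testBit_enc.2 hi
    rw [Nat.testBit_eq_decide_div_mod_eq, decide_eq_true_eq] at this
    change enc s / 2 ^ (i : ℕ) % 2 * _ = _
    rw [this, one_mul]
    rfl
  · intro i hi
    have := mt testBit_enc.1 (Finset.mem_filter.1 hi).2
    rw [Nat.testBit_eq_decide_div_mod_eq, decide_eq_true_eq] at this
    change enc s / 2 ^ (i : ℕ) % 2 * _ = _
    rw [Nat.mod_two_ne_one.1 this, zero_mul]

/-- Combinatorial configurations of ten points and blocks, with three points on each block and
three blocks through each point. -/
structure IsTenThree (C : Finset (Finset (Fin 10))) : Prop where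
  card_block : ∀ s ∈ C, s.card = 3
  card_inter : ∀ s ∈ C, ∀ t ∈ C, s ≠ t → (s ∩ t).card ≤ 1
  card_point : ∀ p, (C.filter (p ∈ ·)).card = 3

/-- The configuration is contained in that of one of the tables, after a relabelling. -/
def EmbedsInTable (C : Finset (Finset (Fin 10))) : Prop :=
  ∃ t ∈ tableMasks, ∃ σ : Equiv.Perm (Fin 10), ∀ s ∈ C, enc (s.map σ.toEmbedding) ∈ t

variable {C : Finset (Finset (Fin 10))}

/-- The preimage of a configuration under a relabelling. -/
def relabel (σ : Equiv.Perm (Fin 10)) (C : Finset (Finset (Fin 10))) : Finset (Finset (Fin 10)) :=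
  Finset.univ.filter fun s => s.map σ.toEmbedding ∈ C

theorem mem_relabel {σ : Equiv.Perm (Fin 10)} {s : Finset (Fin 10)} :
    s ∈ relabel σ C ↔ s.map σ.toEmbedding ∈ C := by
  simp [relabel]

theorem map_symm_map (σ : Equiv.Perm (Fin 10)) (s : Finset (Fin 10)) :
    (s.map σ.symm.toEmbedding).map σ.toEmbedding = s := by
  ext i
  simp

theorem IsTenThree.relabel (h : IsTenThree C) (σ : Equiv.Perm (Fin 10)) :
    IsTenThree (relabel σ C) where
  card_block s hs := by
    rw [← h.card_block _ (mem_relabel.1 hs), Finset.card_map]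
  card_inter s hs t ht hst := by
    have := h.card_inter _ (mem_relabel.1 hs) _ (mem_relabel.1 ht)
      (fun h => hst (Finset.map_injective _ h))
    rwa [← Finset.map_inter, Finset.card_map] at this
  card_point p := by
    rw [← h.card_point (σ p)]
    refine Finset.card_nbij (fun s => s.map σ.toEmbedding) (fun s hs => ?_)
      (fun s _ t _ hst => Finset.map_injective _ hst) (fun s hs => ?_)
    · simpa [mem_relabel] using hs
    · have hs' : s ∈ C ∧ σ p ∈ s := by simpa using hs
      refine ⟨s.map σ.symm.toEmbedding, ?_, map_symm_map σ s⟩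
      simp [mem_relabel, map_symm_map, hs'.1, hs'.2]

theorem EmbedsInTable.of_relabel {σ : Equiv.Perm (Fin 10)} (h : EmbedsInTable (relabel σ C)) :
    EmbedsInTable C := by
  obtain ⟨t, ht, τ, hτ⟩ := h
  refine ⟨t, ht, σ.symm.trans τ, fun s hs => ?_⟩
  have := hτ (s.map σ.symm.toEmbedding) (mem_relabel.2 (by rwa [map_symm_map]))
  rwa [Finset.map_map] at this

/-- A finite set of masks that a permutation maps to itself contains the preimages, too. -/
theorem enc_mem_of_map {l : List ℕ} {σ : Equiv.Perm (Fin 10)}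
    (h : ∀ s, enc s ∈ l → enc (s.map σ.toEmbedding) ∈ l) {s : Finset (Fin 10)}
    (hs : enc (s.map σ.toEmbedding) ∈ l) : enc s ∈ l := by
  classical
  let S : Finset (Finset (Fin 10)) := Finset.univ.filter fun s => enc s ∈ l
  have hS : S.map (Finset.mapEmbedding σ.toEmbedding).toEmbedding ⊆ S := by
    intro t ht
    obtain ⟨s, hs, rfl⟩ := Finset.mem_map.1 ht
    simpa [S] using h s (by simpa [S] using hs)
  have heq := Finset.eq_of_subset_of_card_le hS (by rw [Finset.card_map])
  have : s.map σ.toEmbedding ∈ S := by simpa [S] using hs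
  rw [← heq, Finset.mem_map] at this
  obtain ⟨t, ht, hts⟩ := this
  obtain rfl : t = s := Finset.map_injective _ hts
  simpa [S] using ht

theorem embedsInTable_of_isTable {bs : List ℕ} (h : isTable bs = true)
    (hperm : ∀ l ∈ tablePerms, ∀ m ∈ l, IsPermCode m) (hC : ∀ s ∈ C, enc s ∈ bs) :
    EmbedsInTable C := by
  obtain ⟨⟨t, l⟩, hx, h⟩ := List.any_eq_true.1 h
  rw [forced_eq] at h
  obtain ⟨m, hm, h⟩ := List.any_eq_true.1 h
  have hmem := List.of_mem_zip hx
  obtain ⟨σ, hσ⟩ := (hperm _ hmem.2 m hm).exists_perm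
  refine ⟨t, hmem.1, σ, fun s hs => ?_⟩
  rw [← hσ, ← testBit_setMask]
  exact List.all_eq_true.1 h _ (hC s hs)

/-- Induction on the fuel with the invariant that every member of `bs` is a block of `C` and every
block of `C` is in `bs` or `cands`. It is proved for all `C` at once because a symmetry replaces `C`
by a relabelled configuration. -/
theorem search_sound (hperm : ∀ l ∈ tablePerms, ∀ m ∈ l, IsPermCode m) (fuel : ℕ) :
    ∀ (p : ℕ) (bs cands : List ℕ) (Gs : List (List ℕ)),
      search fuel p bs cands Gs = true → p ≤ 10 → (∀ G ∈ Gs, ∀ m ∈ G, IsPermCode m) →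
      bs.Nodup → (∀ d ∈ cands, d ∉ bs) → (∀ d ∈ cands, ∃ s, enc s = d) →
      ∀ C : Finset (Finset (Fin 10)), IsTenThree C →
      (∀ b ∈ bs, ∃ s ∈ C, enc s = b) → (∀ s ∈ C, enc s ∈ bs ∨ enc s ∈ cands) →
      EmbedsInTable C := by
  induction fuel with
  | zero => intro p bs cands Gs h; exact absurd h Bool.false_ne_true
  | succ fuel ih =>
    intro p bs cands Gs h hp hGs hbs hdisj hcenc C hC hbsC hCbs
    simp only [search, filterThen_eq, forced_eq] at h
    rcases eq_or_ne p 10 with rfl | hp10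
    · rw [Nat.beq_refl, cond_true, Bool.and_eq_true, List.isEmpty_iff] at h
      obtain ⟨rfl, h⟩ := h
      exact embedsInTable_of_isTable h hperm fun s hs => (hCbs s hs).resolve_right (by simp)
    rw [show Nat.beq p 10 = false from natBeq_eq_false_iff.2 hp10, cond_false] at h
    obtain ⟨q, rfl⟩ : ∃ q : Fin 10, (q : ℕ) = p := ⟨⟨p, by omega⟩, rfl⟩
    have hsub : (bs.filter fun b => Nat.testBit b q).toFinset ⊆
        (C.filter (q ∈ ·)).image enc := by
      intro b hb
      rw [List.mem_toFinset, List.mem_filter] at hb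
      obtain ⟨s, hs, rfl⟩ := hbsC b hb.1
      exact Finset.mem_image_of_mem _ (Finset.mem_filter.2 ⟨hs, testBit_enc.1 hb.2⟩)
    have hcard : (bs.filter fun b => Nat.testBit b q).toFinset.card =
        bs.countP fun b => Nat.testBit b q := by
      rw [List.toFinset_card_of_nodup (hbs.filter _), List.countP_eq_length_filter]
    have hthree : ((C.filter (q ∈ ·)).image enc).card = 3 := by
      rw [Finset.card_image_of_injective _ enc_injective, hC.card_point]
    have hle := Finset.card_le_card hsub
    rw [hcard, hthree] at hle
    rcases eq_or_lt_of_le hle with h3 | h3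
    · rw [h3, Nat.beq_refl, cond_true] at h
      have heq := Finset.eq_of_subset_of_card_le hsub (by rw [hthree, hcard, h3])
      refine ih _ _ _ _ h (by omega) hGs hbs (fun d hd => hdisj d (List.mem_filter.1 hd).1)
          (fun d hd => hcenc d (List.mem_filter.1 hd).1) C hC
        hbsC fun s hs => ?_
      by_cases hqs : q ∈ s
      · have : enc s ∈ (C.filter (q ∈ ·)).image enc :=
          Finset.mem_image_of_mem _ (Finset.mem_filter.2 ⟨hs, hqs⟩)
        rw [← heq, List.mem_toFinset, List.mem_filter] at this
        exact Or.inl this.1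
      · refine (hCbs s hs).imp_right fun h => List.mem_filter.2 ⟨h, ?_⟩
        simpa using mt testBit_enc.1 hqs
    rw [show Nat.beq _ 3 = false from natBeq_eq_false_iff.2 h3.ne, cond_false,
      show Nat.blt 3 _ = false from
        Bool.eq_false_iff.2 fun h => absurd (Nat.le_of_ble_eq_true h) (by omega), cond_false] at h
    cases hf : cands.find? fun d => Nat.testBit d q with
    | none =>
      exfalso
      rw [List.find?_eq_none] at hf
      have hss : (C.filter (q ∈ ·)).image enc ⊆
          (bs.filter fun b => Nat.testBit b q).toFinset := by
        intro b hb
        obtain ⟨s, hs, rfl⟩ := Finset.mem_image.1 hb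
        rw [Finset.mem_filter] at hs
        rw [List.mem_toFinset, List.mem_filter]
        refine ⟨(hCbs s hs.1).resolve_right fun h => ?_, testBit_enc.2 hs.2⟩
        exact hf _ h (testBit_enc.2 hs.2)
      have := Finset.card_le_card hss
      omega
    | some c =>
      rw [hf] at h
      simp only at h
      obtain ⟨h1, h2⟩ := Bool.and_eq_true_iff.1 h
      have hc : c ∈ cands := List.mem_of_find?_eq_some hf
      set G := (Gs.headD []).filter fun m => !Nat.beq m permOne &&
        (bs.all fun b => Nat.testBit (setMask bs) (permMask m b 10)) &&
          cands.all fun d => Nat.testBit (setMask cands) (permMask m d 10) with hG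
      have hGperm : ∀ m ∈ G, IsPermCode m := by
        intro m hm
        have hm' := (List.mem_filter.1 hm).1
        cases Gs with
        | nil => simp at hm'
        | cons H Gs => exact hGs H (by simp) m hm'
      have hGs' : ∀ H ∈ Gs.tail, ∀ m ∈ H, IsPermCode m :=
        fun H hH => hGs H (List.mem_of_mem_tail hH)
      -- configurations with the block `c`
      have key : ∀ C : Finset (Finset (Fin 10)), IsTenThree C → (∀ b ∈ bs, ∃ s ∈ C, enc s = b) →
          (∀ s ∈ C, enc s ∈ bs ∨ enc s ∈ cands) → (∃ s ∈ C, enc s = c) → EmbedsInTable C := by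
        rintro C hC hbsC hCbs ⟨s, hs, rfl⟩
        refine ih _ _ _ _ h1 hp ?_ (List.nodup_cons.2 ⟨hdisj _ hc, hbs⟩) ?_
          (fun d hd => hcenc d (List.mem_filter.1 hd).1) C hC ?_ ?_
        · intro H hH
          split at hH
          · rw [List.mem_singleton.1 hH]
            exact hGperm
          · rename_i heq
            rw [← heq] at hH
            exact hGs' H hH
        · intro d hd
          rw [List.mem_filter, Bool.and_eq_true, Bool.not_eq_true', natBeq_eq_false_iff] at hd
          rw [List.mem_cons, not_or]
          exact ⟨hd.2.2, hdisj d hd.1⟩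
        · intro b hb
          rcases List.mem_cons.1 hb with rfl | hb
          · exact ⟨s, hs, rfl⟩
          · exact hbsC b hb
        · intro t ht
          by_cases hst : s = t
          · exact Or.inl (by rw [hst]; exact List.mem_cons_self)
          refine (hCbs t ht).imp (List.mem_cons_of_mem _) fun h => List.mem_filter.2 ⟨h, ?_⟩
          rw [Bool.and_eq_true, Bool.not_eq_true', natBeq_eq_false_iff]
          exact ⟨compat_enc (hC.card_inter s hs t ht hst), fun h => hst (enc_injective h.symm)⟩
      by_cases hCc : ∃ s ∈ C, enc s = c
      · exact key C hC hbsC hCbs hCc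
      -- If `C` contains an image of `c` under a symmetry, its preimage under that symmetry
      -- satisfies the same invariant and contains `c`. Otherwise no block is lost by removing the
      -- images.
      by_cases hO : ∃ s ∈ C, ∃ m ∈ G, enc s = permMask m c 10
      · obtain ⟨s, hs, m, hm, hsm⟩ := hO
        obtain ⟨σ, hσ⟩ := (hGperm m hm).exists_perm
        have hm2 := (List.mem_filter.1 hm).2
        simp only [Bool.and_eq_true, List.all_eq_true, testBit_setMask] at hm2
        have hbsσ : ∀ s, enc s ∈ bs → enc (s.map σ.toEmbedding) ∈ bs := fun s hs => by
          rw [← hσ]; exact hm2.1.2 _ hs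
        have hcaσ : ∀ s, enc s ∈ cands → enc (s.map σ.toEmbedding) ∈ cands := fun s hs => by
          rw [← hσ]; exact hm2.2 _ hs
        refine EmbedsInTable.of_relabel (σ := σ) (key _ (hC.relabel σ) (fun b hb => ?_)
          (fun t ht => (hCbs _ (mem_relabel.1 ht)).imp (enc_mem_of_map hbsσ)
            (enc_mem_of_map hcaσ)) ?_)
        · obtain ⟨u, -, rfl⟩ := hbsC b hb
          obtain ⟨v, hv, hvu⟩ := hbsC _ (hbsσ u hb)
          exact ⟨u, mem_relabel.2 (by rwa [← enc_injective hvu]), rfl⟩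
        · obtain ⟨t, ht⟩ := hcenc c hc
          rw [← ht, hσ] at hsm
          exact ⟨t, mem_relabel.2 (by rwa [← enc_injective hsm]), ht⟩
      · refine ih _ _ _ _ h2 hp ?_ hbs (fun d hd => hdisj d (List.mem_filter.1 hd).1)
          (fun d hd => hcenc d (List.mem_filter.1 hd).1) C hC hbsC
          fun s hs => ?_
        · intro H hH
          rcases List.mem_cons.1 hH with rfl | hH
          · exact hGperm
          · exact hGs' H hH
        · refine (hCbs s hs).imp_right fun h => List.mem_filter.2 ⟨h, ?_⟩
          rw [Bool.and_eq_true, Bool.not_eq_true', Bool.not_eq_true', natBeq_eq_false_iff,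
            ← Bool.not_eq_true, testBit_setMask, List.mem_map]
          exact ⟨fun ⟨m, hm, h⟩ => hO ⟨s, hs, m, hm, h.symm⟩, fun h => hCc ⟨s, hs, h⟩⟩

theorem isPermCode_of_mem_tablePerms : ∀ l ∈ tablePerms, ∀ m ∈ l, IsPermCode m := by
  decide +kernel

theorem isPermCode_of_mem_searchPerms : ∀ l ∈ searchPerms, ∀ m ∈ l, IsPermCode m := by
  decide +kernel

theorem two_pow_add_mem_allMasks : ∀ i j k : Fin 10, i ≠ j → i ≠ k → j ≠ k →
    2 ^ (i : ℕ) + 2 ^ (j : ℕ) + 2 ^ (k : ℕ) ∈ allMasks := by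
  decide +kernel

theorem enc_mem_allMasks {s : Finset (Fin 10)} (hs : s.card = 3) : enc s ∈ allMasks := by
  obtain ⟨i, j, k, hij, hik, hjk, rfl⟩ := Finset.card_eq_three.1 hs
  rw [enc, Finset.sum_insert (by simp [hij, hik]), Finset.sum_insert (by simp [hjk]),
    Finset.sum_singleton, ← add_assoc]
  exact two_pow_add_mem_allMasks i j k hij hik hjk

theorem exists_enc_eq {d : ℕ} (hd : d ∈ allMasks) : ∃ s, enc s = d := by
  simp only [allMasks, List.mem_flatMap, List.mem_map, List.mem_filter, List.mem_range,
    decide_eq_true_eq] at hd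
  obtain ⟨i, hi, j, ⟨hj, hij⟩, k, ⟨hk, hjk⟩, rfl⟩ := hd
  refine ⟨{⟨i, hi⟩, ⟨j, hj⟩, ⟨k, hk⟩}, ?_⟩
  rw [enc, Finset.sum_insert (by simp; omega), Finset.sum_insert (by simp; omega),
    Finset.sum_singleton, ← add_assoc]

/-- The classification of the combinatorial configurations. -/
theorem IsTenThree.embedsInTable (hC : IsTenThree C) : EmbedsInTable C := by
  have h := search_eq_true
  rw [filterThen_eq, List.filter_true] at h
  exact search_sound isPermCode_of_mem_tablePerms 150 0 [] allMasks searchPerms h (by norm_num)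
    isPermCode_of_mem_searchPerms List.nodup_nil (by simp) (fun d hd => exists_enc_eq hd) C hC
    (by simp) fun s hs => Or.inr (enc_mem_allMasks (hC.card_block s hs))

end Soundness

/-! ### Isomorphism invariants of tables -/

section Invariants

variable {n : ℕ}

/-- The lines `i` and `j` meet in a double point. -/
def MeetsInDouble (C : ConfigurationTable n) (i j : Fin n) : Prop :=
  i ≠ j ∧ ∀ k, i ≠ k → j ≠ k → ¬ Shares C i j k

instance (C : ConfigurationTable n) (i j : Fin n) : Decidable (MeetsInDouble C i j) :=
  inferInstanceAs (Decidable (_ ∧ ∀ _, _))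

/-- The number of ordered triples of lines that are pairwise related by `r`. -/
def triangles (r : Fin n → Fin n → Prop) [DecidableRel r] : ℕ :=
  (Finset.univ.filter fun x : Fin n × Fin n × Fin n => r x.1 x.2.1 ∧ r x.1 x.2.2 ∧
    r x.2.1 x.2.2).card

/-- The number of lines that are related by `r` to three lines through a common point. -/
def stars (C : ConfigurationTable n) (r : Fin n → Fin n → Prop) [DecidableRel r] : ℕ :=
  (Finset.univ.filter fun i : Fin n => ∃ a, r i a ∧ ∃ b, r i b ∧ a ≠ b ∧ ∃ c, r i c ∧
    (a ≠ c ∧ b ≠ c) ∧ Shares C a b c).card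

/-- The two tables are isomorphic through `π`. -/
def TableIso (π : Equiv.Perm (Fin n)) (C D : ConfigurationTable n) : Prop :=
  ∀ i j k, i ≠ j → i ≠ k → j ≠ k → (Shares C i j k ↔ Shares D (π i) (π j) (π k))

variable {C D : ConfigurationTable n} {π : Equiv.Perm (Fin n)}

theorem TableIso.meetsInDouble_iff (h : TableIso π C D) (i j : Fin n) :
    MeetsInDouble C i j ↔ MeetsInDouble D (π i) (π j) := by
  rw [MeetsInDouble, MeetsInDouble, π.injective.ne_iff]
  refine and_congr_right fun hij => π.forall_congr fun k => ?_
  rw [π.injective.ne_iff, π.injective.ne_iff]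
  exact forall_congr' fun hik => forall_congr' fun hjk => not_congr (h i j k hij hik hjk)

theorem TableIso.triangles_eq (h : TableIso π C D) :
    triangles (MeetsInDouble C) = triangles (MeetsInDouble D) := by
  refine Finset.card_equiv (π.prodCongr (π.prodCongr π)) fun x => ?_
  simp [h.meetsInDouble_iff]

theorem TableIso.stars_eq (h : TableIso π C D) :
    stars C (MeetsInDouble C) = stars D (MeetsInDouble D) := by
  refine Finset.card_equiv π fun i => ?_
  simp only [Finset.mem_filter, Finset.mem_univ, true_and, h.meetsInDouble_iff]
  refine π.exists_congr fun a => and_congr_right fun _ => ?_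
  refine π.exists_congr fun b => and_congr_right fun _ => ?_
  rw [π.injective.ne_iff]
  refine and_congr_right fun hab => π.exists_congr fun c => and_congr_right fun _ => ?_
  rw [π.injective.ne_iff, π.injective.ne_iff]
  exact and_congr_right fun hc => h a b c hab hc.1 hc.2

/-- No block of the table with number `c` contains `i` and `j`. -/
def MaskDouble (c : Fin 9) (i j : Fin 10) : Prop :=
  i ≠ j ∧ ∀ m ∈ tableMasks.getD c [], ¬ (m.testBit i = true ∧ m.testBit j = true)

instance (c : Fin 9) : DecidableRel (MaskDouble c) :=
  fun _ _ => inferInstanceAs (Decidable (_ ∧ _))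

/-- Bit tests replace intersections of finite sets, which makes the counts cheap to evaluate. -/
theorem meetsInDouble_tenThreeTable :
    ∀ c, MeetsInDouble (tenThreeTable c) = MaskDouble c := by
  have : ∀ c i j, MeetsInDouble (tenThreeTable c) i j ↔ MaskDouble c i j := by
    decide +kernel
  exact fun c => funext₂ fun i j => propext (this c i j)

theorem triangles_maskDouble : ∀ c, triangles (MaskDouble c) =
    ![0, 12, 12, 6, 18, 18, 6, 12, 0] c := by
  decide +kernel

theorem stars_maskDouble : ∀ c, stars (tenThreeTable c) (MaskDouble c) =
    ![10, 4, 2, 1, 1, 0, 0, 0, 0] c := by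
  decide +kernel

/-- The nine pairs of values of the two invariants are distinct; neither invariant suffices alone.
-/
theorem TableIso.eq {c c' : Fin 9} {π : Equiv.Perm (Fin 10)}
    (h : TableIso π (tenThreeTable c) (tenThreeTable c')) : c = c' := by
  have h1 := h.triangles_eq
  have h2 := h.stars_eq
  simp only [meetsInDouble_tenThreeTable] at h1 h2
  have h1' := (triangles_maskDouble c).symm.trans (h1.trans (triangles_maskDouble c'))
  have h2' := (stars_maskDouble c).symm.trans (h2.trans (stars_maskDouble c'))
  clear h h1 h2
  decide +revert

theorem HasTable.tableIso {A : Fin n → DualPlane} {σ τ : Equiv.Perm (Fin n)}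
    (hC : HasTable (A ∘ σ) C) (hD : HasTable (A ∘ τ) D) : TableIso (σ.trans τ.symm) C D := by
  intro i j k hij hik hjk
  rw [← (hasTable_iff.1 hC).2 i j k hij hik hjk, ← (hasTable_iff.1 hD).2 _ _ _
    (by simpa using hij) (by simpa using hik) (by simpa using hjk)]
  simp

end Invariants

/-! ### The classification -/

section Classification

/-- The blocks of `t` are the points of the table `C`. -/
def IsMaskTable (t : List ℕ) (C : ConfigurationTable 10) : Prop :=
  t.length = 10 ∧ ∀ i j k : Fin 10, i ≠ j → i ≠ k → j ≠ k →
    (Shares C i j k ↔ ∃ m ∈ t, m.testBit i = true ∧ m.testBit j = true ∧ m.testBit k = true)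

instance (t : List ℕ) (C : ConfigurationTable 10) : Decidable (IsMaskTable t C) :=
  inferInstanceAs (Decidable (_ ∧ ∀ _, _))

theorem isMaskTable_tenThreeTable :
    ∀ c : Fin 9, IsMaskTable (tableMasks.getD c []) (tenThreeTable c) := by
  decide +kernel

theorem isMaskTable_antiTable : IsMaskTable (tableMasks.getD 9 []) antiTable := by
  decide +kernel

variable {A : Fin 10 → DualPlane}

open Classical in
/-- The labels of the lines through `x`. -/
noncomputable def linesThrough (A : Fin 10 → DualPlane) (x : Plane) : Finset (Fin 10) :=
  Finset.univ.filter fun i => x ∈ line (A i)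

theorem mem_linesThrough {x : Plane} {i : Fin 10} : i ∈ linesThrough A x ↔ x ∈ line (A i) := by
  simp [linesThrough]

theorem card_linesThrough (x : Plane) : (linesThrough A x).card = multiplicity A x := by
  rw [multiplicity, ← Set.ncard_coe_finset]
  congr 1
  ext i
  simp [mem_linesThrough]

theorem eq_of_mem_linesThrough (hA : Function.Injective A) {x y : Plane} {i j : Fin 10}
    (hij : i ≠ j) (hx : i ∈ linesThrough A x ∧ j ∈ linesThrough A x)
    (hy : i ∈ linesThrough A y ∧ j ∈ linesThrough A y) : x = y := by
  simp only [mem_linesThrough] at hx hy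
  exact eq_of_mem_line (hA.ne hij) hx.1 hx.2 hy.1 hy.2

theorem linesThrough_injOn (hA : Function.Injective A) :
    Set.InjOn (linesThrough A) (triplePoints A) := by
  intro x hx y _ hxy
  have h3 : 1 < (linesThrough A x).card := by
    rw [card_linesThrough, show multiplicity A x = 3 from hx]
    norm_num
  obtain ⟨i, hi, j, hj, hij⟩ := Finset.one_lt_card.1 h3
  exact eq_of_mem_linesThrough hA hij ⟨hi, hj⟩ ⟨hxy ▸ hi, hxy ▸ hj⟩

theorem IsTenLinesTenTriples.finite_triplePoints (h : IsTenLinesTenTriples A) :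
    (triplePoints A).Finite :=
  Set.finite_of_ncard_ne_zero (by rw [h.ten_triples]; norm_num)

/-- The triple points, as sets of labels of lines. -/
theorem IsTenLinesTenTriples.exists_isTenThree (h : IsTenLinesTenTriples A) :
    ∃ C : Finset (Finset (Fin 10)), IsTenThree C ∧ C.card = 10 ∧
      ∀ s, s ∈ C ↔ ∃ x ∈ triplePoints A, linesThrough A x = s := by
  classical
  have hfin := h.finite_triplePoints
  obtain ⟨C, hCdef⟩ : ∃ C, C = hfin.toFinset.image (linesThrough A) := ⟨_, rfl⟩
  have hC : ∀ s, s ∈ C ↔ ∃ x ∈ triplePoints A, linesThrough A x = s := by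
    simp [hCdef]
  have hcard : C.card = 10 := by
    rw [hCdef, Finset.card_image_of_injOn (by simpa using linesThrough_injOn h.injective),
      ← Set.ncard_eq_toFinset_card _ hfin, h.ten_triples]
  have hblock : ∀ s ∈ C, s.card = 3 := by
    intro s hs
    obtain ⟨x, hx, rfl⟩ := (hC s).1 hs
    rw [card_linesThrough]
    exact hx
  have hpoint : ∀ p ∈ (Finset.univ : Finset (Fin 10)), 3 ≤ (C.filter (p ∈ ·)).card := by
    intro p _
    refine (h.three_le p).trans ?_
    rw [← Set.ncard_coe_finset, ← ((linesThrough_injOn h.injective).mono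
      Set.inter_subset_left).ncard_image]
    refine Set.ncard_le_ncard ?_ (Finset.finite_toSet _)
    rintro _ ⟨x, ⟨hx, hxp⟩, rfl⟩
    simp only [Finset.coe_filter, Set.mem_ofPred_eq]
    exact ⟨(hC _).2 ⟨x, hx, rfl⟩, mem_linesThrough.2 hxp⟩
  -- Double counting of incidences: the total is 30, so the lower bound 3 is attained on every line.
  have hsum : ∑ p : Fin 10, (C.filter (p ∈ ·)).card = ∑ _p : Fin 10, 3 := by
    have := Finset.sum_card_bipartiteAbove_eq_sum_card_bipartiteBelow
      (s := (Finset.univ : Finset (Fin 10))) (t := C) (fun p s => p ∈ s)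
    simp only [Finset.bipartiteAbove, Finset.bipartiteBelow, Finset.filter_univ_mem] at this
    rw [this, Finset.sum_congr rfl hblock, Finset.sum_const, hcard]
    rfl
  refine ⟨C, ⟨hblock, fun s hs t ht hst => ?_, fun p => ?_⟩, hcard, hC⟩
  · by_contra! hlt
    obtain ⟨i, hi, j, hj, hij⟩ := Finset.one_lt_card.1 hlt
    obtain ⟨x, -, rfl⟩ := (hC s).1 hs
    obtain ⟨y, -, rfl⟩ := (hC t).1 ht
    rw [Finset.mem_inter] at hi hj
    exact hst (by rw [eq_of_mem_linesThrough h.injective hij ⟨hi.1, hj.1⟩ ⟨hi.2, hj.2⟩])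
  · exact (((Finset.sum_eq_sum_iff_of_le hpoint).1 hsum.symm) p (Finset.mem_univ p)).symm

theorem IsTenLinesTenTriples.exists_hasTable (h : IsTenLinesTenTriples A) :
    ∃ t ∈ tableMasks, ∀ C, IsMaskTable t C → ∃ σ : Equiv.Perm (Fin 10), HasTable (A ∘ σ) C := by
  classical
  obtain ⟨D, hD, hcard, hmem⟩ := h.exists_isTenThree
  obtain ⟨t, ht, τ, hτ⟩ := hD.embedsInTable
  refine ⟨t, ht, fun C ⟨hlen, hC⟩ => ⟨τ.symm, h.injective.comp τ.symm.injective, ?_⟩⟩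
  intro i j k hij hik hjk
  have hinj : Function.Injective fun s : Finset (Fin 10) => enc (s.map τ.toEmbedding) :=
    enc_injective.comp (Finset.map_injective τ.toEmbedding)
  -- The embedding is onto, since there are ten blocks on both sides.
  have heq : D.image (fun s => enc (s.map τ.toEmbedding)) = t.toFinset := by
    refine Finset.eq_of_subset_of_card_le (fun m hm => ?_) ?_
    · obtain ⟨s, hs, rfl⟩ := Finset.mem_image.1 hm
      exact List.mem_toFinset.2 (hτ s hs)
    · rw [Finset.card_image_of_injective D hinj, hcard]
      exact (List.toFinset_card_le t).trans hlen.le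
  have hbit : ∀ x i, (enc ((linesThrough A x).map τ.toEmbedding)).testBit (i : Fin 10) = true ↔
      x ∈ line (A (τ.symm i)) := by
    intro x i
    rw [testBit_enc, Finset.mem_map_equiv, mem_linesThrough]
  rw [← shares_iff, hC i j k hij hik hjk]
  constructor
  · rintro ⟨x, ⟨hi, hj⟩, hk⟩
    have hx : x ∈ triplePoints A := by
      refine le_antisymm (h.multiplicity_le x) ?_
      rw [← card_linesThrough]
      exact Finset.two_lt_card_iff.2 ⟨_, _, _, mem_linesThrough.2 hi, mem_linesThrough.2 hj,
        mem_linesThrough.2 hk, τ.symm.injective.ne hij, τ.symm.injective.ne hik,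
        τ.symm.injective.ne hjk⟩
    exact ⟨_, hτ _ ((hmem _).2 ⟨x, hx, rfl⟩), (hbit x i).2 hi, (hbit x j).2 hj, (hbit x k).2 hk⟩
  · rintro ⟨m, hm, hi, hj, hk⟩
    rw [← List.mem_toFinset, ← heq, Finset.mem_image] at hm
    obtain ⟨s, hs, rfl⟩ := hm
    obtain ⟨x, -, rfl⟩ := (hmem s).1 hs
    exact ⟨x, ⟨(hbit x i).1 hi, (hbit x j).1 hj⟩, (hbit x k).1 hk⟩

theorem IsTenLinesTenTriples.exists_hasTable_tenThreeTable (h : IsTenLinesTenTriples A) :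
    ∃ (c : Fin 9) (σ : Equiv.Perm (Fin 10)), HasTable (A ∘ σ) (tenThreeTable c) := by
  obtain ⟨t, ht, hσ⟩ := h.exists_hasTable
  obtain ⟨l, hl, rfl⟩ := List.mem_iff_getElem.1 ht
  rw [← List.getD_eq_getElem _ [] hl] at hσ
  replace hl : l < 10 := hl
  -- The entry of `tableMasks` with index 9 is the non-realizable configuration.
  rcases eq_or_lt_of_le (Nat.le_of_lt_succ hl) with rfl | hl
  · obtain ⟨σ, hσ⟩ := hσ _ isMaskTable_antiTable
    exact absurd hσ.isRealization not_isRealization_antiTable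
  · exact ⟨⟨l, hl⟩, hσ _ (isMaskTable_tenThreeTable ⟨l, hl⟩)⟩

theorem hasChart_tenThreeTable (c : Fin 9) : HasChart (tenThreeTable c) := by
  fin_cases c
  exacts [hasChartOne, hasChartTwo, hasChartThree, hasChartFour, hasChartFive, hasChartSix,
    hasChartSeven, hasChartEight, hasChartNine]

theorem IsTenLinesTenTriples.irreducibleSpace (h : IsTenLinesTenTriples A) :
    IrreducibleSpace (ModuliSpace A) := by
  obtain ⟨c, σ, hσ⟩ := h.exists_hasTable_tenThreeTable
  exact hσ.irreducibleSpace (hasChart_tenThreeTable c) (tenThreeTable_exists_not_shares c)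

end Classification

end LineArrangement

theorem theorem6p2 :
    -- each of the nine tables is realized by an arrangement of ten lines with ten triple points
    (∀ c : Fin 9, ∃ A : Fin 10 → LineArrangement.DualPlane,
      LineArrangement.IsTenLinesTenTriples A ∧
        LineArrangement.HasTable A (LineArrangement.tenThreeTable c)) ∧
    -- up to relabelling the lines, every such arrangement has exactly one of the nine tables
    (∀ A : Fin 10 → LineArrangement.DualPlane, LineArrangement.IsTenLinesTenTriples A →
      ∃! c : Fin 9, ∃ σ : Equiv.Perm (Fin 10),
        LineArrangement.HasTable (A ∘ σ) (LineArrangement.tenThreeTable c)) ∧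
    -- the moduli spaces are irreducible
    (∀ A : Fin 10 → LineArrangement.DualPlane, LineArrangement.IsTenLinesTenTriples A →
      IrreducibleSpace (LineArrangement.ModuliSpace A)) ∧
    -- there are no potential Zariski pairs
    (∀ A B : Fin 10 → LineArrangement.DualPlane, LineArrangement.IsTenLinesTenTriples A →
      ¬ LineArrangement.IsPotentialZariskiPair A B) := by
  refine ⟨LineArrangement.exists_hasTable_tenThreeTable, fun A hA => ?_,
    fun A hA => hA.irreducibleSpace, fun A B hA => ?_⟩
  · obtain ⟨c, σ, hσ⟩ := hA.exists_hasTable_tenThreeTable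
    exact ⟨c, ⟨σ, hσ⟩, fun c' ⟨τ, hτ⟩ => (hτ.tableIso hσ).eq⟩
  · have := hA.irreducibleSpace
    exact LineArrangement.not_isPotentialZariskiPair_of_irreducibleSpace B
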